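/- Let $d\le 2$ be an integer and $n\ge 0$ an integer with $n+d-1\ge 0$. A \emph{$d$-descending plane partition with entries $\le n$} is, for $d\le 1$, an array $\pi$ of positive integers $\le n$ with rows $\pi_{i,i},\pi_{i,i+1},\dots,\pi_{i,\lambda_i}$, $1\le i\le k$ ($k\ge 0$), such that (1) $\lambda_1\ge\dots\ge\lambda_k\ge k$; (2) entries weakly decrease along rows; (3) entries strictly decrease along columns; (4) the first entry of each row does not exceed the number of entries of the preceding row less $d$, but is greater than the number of entries of its own row less $d$. For $d=2$ the definition is modified: $0$ is also allowed as an entry, and in addition the first entry of each row must be equal to the number of entries of its row less $d-1$. Order these arrays by: $\pi\le\sigma$ iff, whenever $\pi_{i,j}$ exists, $\sigma_{i,j}$ also exists and $\pi_{i,j}\le\sigma_{i,j}$. Consider the hexagon with angles $120^\circ$ and side lengths $n+d-1,n+1,n+d-1,n+1,n+d-1,n+1$, two of its sides being vertical and the vertical one on the right having length $n+1$, from whose centre an equilateral triangle of side length $2-d$, with sides parallel and nearest to the sides of length $n+1$ of the hexagon, has been removed, and its tilings by unit rhombi with angles $60^\circ$ and $120^\circ$. Such a tiling is cyclically symmetric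 if it is invariant under rotation by $120^\circ$. Restrict a cyclically symmetric tiling to the fundamental region, namely the parallelogram spanned by the upper-right side and the right vertical side of the hexagon, and use in it coordinates $(x,y)$ with $x$ counting the vertical strips of width $\sqrt3/2$ from the left border and $y$ the height above the bottom border of the parallelogram along vertical lines. The rhombi cut in two by the left border, at heights $y$, are the origins of lattice paths starting in $(0,y)$, which run through the tiling by horizontal unit steps (through the rhombi whose long diagonal is horizontal) and downward vertical unit steps (through the rhombi with two vertical edges and two edges directed from south-west to north-east), and end in the rhombi cut in two by the bottom border. Read off from each path the height of its starting point followed by the heights of its horizontal steps, dropping the heights $0$ if $d\le 1$. Then: (a) The $d$-descending plane partitions with entries $\le n$ form a lattice under the above order. (b) Taking the sequences read off from the paths of a tiling as the rows of an array defines a bijection between the cyclically symmetric rhombus tilings of the hexagon with triangular hole and the $d$-descending plane partitions with entries $\le n$. (c) Under this bijection, the reflection of tilings in the horizontal symmetry axis of the hexagon with triangular hole corresponds to an antiautomorphism of the lattice in (a) (for $d=2$ as well). (d) If $d\le 1$, or if $d=2$ and $n\le 1$, this is the unique antiautomorphism of the lattice. -/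

import Mathlib

/-! ### `d`-descending plane partitions -/

/-- The entry in row `i` and column `j` (both counted from `0`) of the shifted array whose
`i`-th row is the list `rows[i]`, placed so that it starts in column `i`; it is `none` if the
array has no entry at this position. -/
def arrayEntry (rows : List (List ℕ)) (i j : ℕ) : Option ℕ :=
  if i ≤ j then (rows[i]?).bind (fun r => r[j - i]?) else none

/-- `d`-descending plane partitions (`d ≤ 2`) with entries `≤ n`: shifted arrays
`π₁₁ … π_{1,λ₁} / π₂₂ … π_{2,λ₂} / … / π_{kk} … π_{k,λ_k}` (the number `k` of rows may be `0`).
Row number `i` (counted from `0`) has `r.length` entries, so that the number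
`λ` of that row is `i + r.length`.  For `d = 2` the definition is the modified one: `0` is also
allowed as an entry, and the first entry of each row equals the number of entries
of its row less `d - 1`. -/
@[ext]
structure DescendingPP (d : ℤ) (n : ℕ) where
  /-- the rows of the array, from top to bottom -/
  rows : List (List ℕ)
  /-- every row has an entry; together with `shape` this is `λ₁ ≥ ⋯ ≥ λ_k ≥ k` -/
  row_ne_nil : ∀ r ∈ rows, r ≠ []
  shape : ∀ (i : ℕ) (r s : List ℕ), rows[i]? = some r → rows[i + 1]? = some s →
    (i + 1) + s.length ≤ i + r.length
  entry_le : ∀ r ∈ rows, ∀ v ∈ r, v ≤ n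
  entry_pos : d ≠ 2 → ∀ r ∈ rows, ∀ v ∈ r, 0 < v
  rows_weak : ∀ i j v w : ℕ, arrayEntry rows i j = some v → arrayEntry rows i (j + 1) = some w →
    w ≤ v
  cols_strict : ∀ i j v w : ℕ, arrayEntry rows i j = some v → arrayEntry rows (i + 1) j = some w →
    w < v
  /-- the first entry of a row does not exceed the number of entries in the preceding row
  less `d` -/
  first_le : ∀ (i : ℕ) (r s : List ℕ) (v : ℕ), rows[i]? = some r → rows[i + 1]? = some s →
    s.head? = some v → (v : ℤ) ≤ (r.length : ℤ) - d
  /-- the first entry of a row is greater than the number of entries in its own row less `d` -/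
  lt_first : ∀ r ∈ rows, ∀ v : ℕ, r.head? = some v → (r.length : ℤ) - d < (v : ℤ)
  first_eq : d = 2 → ∀ r ∈ rows, ∀ v : ℕ, r.head? = some v → (v : ℤ) = (r.length : ℤ) - (d - 1)

namespace DescendingPP

variable {d : ℤ} {n : ℕ}

theorem rows_le_aux {π σ : DescendingPP d n} (h : ∀ i j, arrayEntry π.rows i j = arrayEntry σ.rows i j)
    {i : ℕ} {r : List ℕ} (hr : π.rows[i]? = some r) : σ.rows[i]? = some r := by
  have hne := π.row_ne_nil r (List.mem_of_getElem? hr)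
  have h0 := h i i
  simp only [arrayEntry, le_refl, if_true, hr, Option.bind_some, Nat.sub_self] at h0
  cases hs : σ.rows[i]? with
  | none =>
    simp [hs] at h0
    exact absurd h0 hne
  | some s =>
    congr 1
    apply List.ext_getElem?
    intro j
    have hj := h i (i + j)
    simpa [arrayEntry, hr, hs] using hj.symm

/-- `π ≤ σ` if, whenever `π` has an entry at a position, then `σ` also has an entry there, and
it is at least as large. -/
instance : PartialOrder (DescendingPP d n) where
  le π σ := ∀ i j v : ℕ, arrayEntry π.rows i j = some v →
    ∃ w : ℕ, arrayEntry σ.rows i j = some w ∧ v ≤ w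
  le_refl π i j v h := ⟨v, h, le_rfl⟩
  le_trans π σ ρ h₁ h₂ i j v h := by
    obtain ⟨w, hw, hvw⟩ := h₁ i j v h
    obtain ⟨x, hx, hwx⟩ := h₂ i j w hw
    exact ⟨x, hx, hvw.trans hwx⟩
  le_antisymm π σ h₁ h₂ := by
    have key : ∀ i j, arrayEntry π.rows i j = arrayEntry σ.rows i j := by
      intro i j
      cases h : arrayEntry π.rows i j with
      | some v =>
        obtain ⟨w, hw, hvw⟩ := h₁ i j v h
        obtain ⟨x, hx, hwx⟩ := h₂ i j w hw
        rw [h] at hx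
        cases hx
        rw [hw, le_antisymm hvw hwx]
      | none =>
        cases h' : arrayEntry σ.rows i j with
        | none => rfl
        | some w =>
          obtain ⟨x, hx, _⟩ := h₂ i j w h'
          rw [h] at hx
          cases hx
    apply DescendingPP.ext
    apply List.ext_getElem?
    intro i
    cases hr : π.rows[i]? with
    | some r => exact (rows_le_aux key hr).symm
    | none =>
      cases hs : σ.rows[i]? with
      | none => rfl
      | some s =>
        have := rows_le_aux (fun i j => (key i j).symm) hs
        rw [hr] at this
        cases this

end DescendingPP

/-! ### Rhombus tilings of the hexagon with triangular hole

Barycentric coordinates: the plane `x₀ + x₁ + x₂ = 2a + b` carries the triangular lattice cut out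
by the lines `xᵢ = c`, `c ∈ ℤ`, `i = 0, 1, 2`.  In this plane,
* `{0 ≤ xᵢ ≤ a + b for all i}` is a hexagon with all angles `120°`, whose side lengths are
  alternately `a` (the sides on `xᵢ = a + b`) and `b` (the sides on `xᵢ = 0`);
* `{xᵢ ≥ a for all i}` is the equilateral triangle of side length `b - a` with the same centre
  whose sides are parallel and nearest to the sides of length `b` of the hexagon
  (a single point if `b = a`);
* the unit lattice triangles are the sets `{x | ⌊xᵢ⌋ = tᵢ}` (up to boundary) with `t ∈ ℤ³`
  and `t₀ + t₁ + t₂ ∈ {2a + b - 1, 2a + b - 2}`, the two values of the sum distinguishing the two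
  orientations; we name such a triangle by `t`.
Two unit triangles share an edge iff they are `t` and `t - eᵢ` for some `i`
(the edge lies on `xᵢ = tᵢ`). -/

/-- The unit triangle with name `t` lies in the hexagon with side lengths `a, b, a, b, a, b`, and
not in the triangle of side length `b - a` which is removed from the centre of the hexagon. -/
def InHoleyHexagon (a b : ℤ) (t : Fin 3 → ℤ) : Prop :=
  (∑ i, t i = 2 * a + b - 1 ∨ ∑ i, t i = 2 * a + b - 2) ∧
    (∀ i, 0 ≤ t i ∧ t i < a + b) ∧ ¬ ∀ i, a ≤ t i

/-- A unit rhombus: the union of the triangle `tri` and the triangle `tri - e_dir`, which share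
an edge on a line on which the coordinate `dir` is constant. -/
@[ext]
structure Rhombus where
  tri : Fin 3 → ℤ
  dir : Fin 3

/-- The two unit triangles that form a rhombus. -/
def Rhombus.cells (R : Rhombus) : Set (Fin 3 → ℤ) :=
  {R.tri, R.tri - Pi.single R.dir 1}

/-- The action of a permutation of the three coordinates on rhombi. -/
def Rhombus.permute (σ : Equiv.Perm (Fin 3)) (R : Rhombus) : Rhombus :=
  ⟨fun i => R.tri (σ.symm i), σ R.dir⟩

/-- The rotation by `120°` about the centre of the hexagon. -/
def Rhombus.rotate (R : Rhombus) : Rhombus := R.permute (finRotate 3)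

/-- The reflection in the symmetry axis `x₁ = x₂` of the hexagon with hole.  We picture the sides
on `x₀ = 0` and on `x₀ = a + b` as the vertical right and left sides;
then this is the horizontal symmetry axis. -/
def Rhombus.reflect (R : Rhombus) : Rhombus := R.permute (Equiv.swap 1 2)

/-- A set of rhombi tiles the hexagon with side lengths `a, b, a, b, a, b` from which the triangle
of side length `b - a` has been removed: all rhombi lie in the region, and every unit triangle of
the region is covered by exactly one of them. -/
def IsRhombusTiling (a b : ℤ) (T : Set Rhombus) : Prop :=
  (∀ R ∈ T, ∀ t ∈ R.cells, InHoleyHexagon a b t) ∧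
    ∀ t, InHoleyHexagon a b t → ∃! R, R ∈ T ∧ t ∈ R.cells

/-- The cyclically symmetric rhombus tilings, i.e. those invariant under rotation by `120°`. -/
def CSRhombusTiling (a b : ℤ) : Type :=
  {T : Set Rhombus // IsRhombusTiling a b T ∧ Rhombus.rotate '' T = T}

/-! ### The lattice paths of a tiling

The fundamental region is the parallelogram `0 ≤ x₀ ≤ a`, `a ≤ x₂ ≤ a + b`, with horizontal
coordinate `x = a - x₀` (to the right) and height `y = x₂ - a` along vertical lines.  Its left
border is `x₀ = a` and its bottom border is `x₂ = a`.  The points `(x, y)` of the lattice paths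
are the midpoints of the edges from the vertex `(a - x, b + x - y, a + y)` to the
vertex `(a - x - 1, b + x - y, a + y + 1)`. -/

/-- The horizontally oriented rhombus through which a path makes a horizontal step from
`(x, y)` to `(x + 1, y)`; for `x = -1` this is the rhombus cut in two by the left border in
which a path with starting point `(0, y)` originates. -/
def horizontalRhombus (a b x y : ℤ) : Rhombus := ⟨![a - x - 1, b + x - y, a + y], 0⟩

/-- The rhombus through which a path makes a vertical step from `(x, y)` to `(x, y - 1)`; for
`y = 0` this is the rhombus cut in two by the bottom border in which a path with end
point `(x, 0)` terminates. -/
def verticalRhombus (a b x y : ℤ) : Rhombus := ⟨![a - x - 1, b + x - y, a + y], 2⟩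

/-- `IsPathFrom a b T x y w`: the rhombi of `T` form a lattice path from `(x, y)` to some
end point on the bottom border, and `w` is the list of heights of its horizontal steps. -/
inductive IsPathFrom (a b : ℤ) (T : Set Rhombus) : ℕ → ℕ → List ℕ → Prop
  | finish (x : ℕ) : verticalRhombus a b x 0 ∈ T → IsPathFrom a b T x 0 []
  | right (x y : ℕ) (w : List ℕ) : horizontalRhombus a b x y ∈ T →
      IsPathFrom a b T (x + 1) y w → IsPathFrom a b T x y (y :: w)
  | down (x y : ℕ) (w : List ℕ) : verticalRhombus a b x ((y : ℤ) + 1) ∈ T →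
      IsPathFrom a b T x y w → IsPathFrom a b T x (y + 1) w

/-- `w` is the list of heights read off from a path of `T` that starts at the left border: the
height of the starting point, followed by the heights of the horizontal steps. -/
def IsPathWord (a b : ℤ) (T : Set Rhombus) (w : List ℕ) : Prop :=
  ∃ (y : ℕ) (u : List ℕ), horizontalRhombus a b (-1) y ∈ T ∧ IsPathFrom a b T 0 y u ∧ w = y :: u

/-- The array `π` is read off from the tiling `T`: its rows are the lists of heights of
the paths of `T`, where, if `d ≠ 2`, heights `0` are dropped. -/
def ReadOff {d : ℤ} {n : ℕ} (a b : ℤ) (T : Set Rhombus) (π : DescendingPP d n) : Prop :=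
  ∀ r : List ℕ, r ∈ π.rows ↔
    ∃ w : List ℕ, IsPathWord a b T w ∧ r = if d = 2 then w else w.filter (fun v => 0 < v)

/-!
All parts of the theorem become transparent once a cyclically symmetric tiling is encoded by a
height function on the fundamental parallelogram: `c x y` is the number of lattice paths that enter
the vertical line `x` at height at least `y`.  With `a = n + d - 1` and `m = 2 - d`, the functions
that arise are exactly the `c : ℕ → ℕ → ℕ` that decrease weakly in both variables, drop by at most
`1` along diagonal steps, vanish for `x ≥ a`, and satisfy `c 0 (x + m) = c x 0`; the last condition
expresses the rotational symmetry, since it glues the bottom border of the parallelogram to its left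
border (`CyclicHeight`).  These conditions are preserved by pointwise maxima and minima, so that
the height functions form a distributive lattice.

* Descending plane partitions.  The entry in row `i` and place `x` (both counted from `0`) is the
  largest `v` with `i < c x v`; in other words, the columns of the array and the
  height function are conjugate to each other.  Weak decrease in the rows, strict decrease in the columns and the conditions on
  the first entries translate into the conditions on `c`, and entrywise order into pointwise
  order (`DescendingPP.exists_orderIso_matches`).  For `d ≤ 1` a dropped `0` loses no information,
  because the first entry of a row determines where its path ends.
* Tilings.  The way in which the two unit triangles of a cell are covered corresponds to local
  differences of `c` (`CyclicHeight.isRhombusTiling_tiling`).  Conversely, in every tiling the two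
  triangles of each cell give a conservation law for paths, from which the conditions
  on `c` follow by summation (`CyclicHeight.exists_tiling_eq`).  Following a path through the tiling
  then reads off a row of the array (`CyclicHeight.readOff_tiling`).
* Reflection.  The reflection acts on height functions by an explicit formula of the form
  "linear function minus `c` at the reflected point", and hence reverses the order
  (`CyclicHeight.reflectIso`, `CyclicHeight.tiling_reflect`).
* Uniqueness.  Two antiautomorphisms differ by an automorphism, so it suffices that the identity is
  the only automorphism (`CyclicHeight.orderIso_apply_eq`).  Every height function is a join
  of sup-irreducible ones, and these are the least functions with a prescribed lower bound `h` at a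
  point `(x, y)`.  They are given by a distance function, so that their order is explicit
  (`CyclicHeight.least_le_least`).  By induction an automorphism fixes all of them: a
  sup-irreducible element is determined by the elements strictly below it, with the single
  exception of the pair of triples `(x, y, h) = (1, 1, 1)` and `(2, 0, 1)`, whose members cannot be
  interchanged because the order above them is not symmetric (`CyclicHeight.not_swap`).
  For `m = 0` this fails as soon as `a ≥ 3`, where transposition is a nontrivial automorphism.
-/

/-! ### Cyclic height functions -/

/-- The height functions of the cyclically symmetric tilings of the hexagon with side lengths
`a` and `a + m` and with a triangular hole of side length `m`, restricted to the fundamental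
parallelogram.  The value at `(x, y)` is the number of lattice paths that enter the vertical line
with coordinate `x` at height at least `y`.  The domain is extended to the whole quadrant by the
value `0`; `glue` identifies the left border with the bottom border. -/
@[ext]
structure CyclicHeight (a m : ℕ) where
  val : ℕ → ℕ → ℕ
  right_le : ∀ x y, val (x + 1) y ≤ val x y
  up_le : ∀ x y, val x (y + 1) ≤ val x y
  le_diag : ∀ x y, val x y ≤ val (x + 1) (y + 1) + 1
  glue : ∀ x, val 0 (x + m) = val x 0
  vanish : val a 0 = 0

namespace CyclicHeight

variable {a m : ℕ}

instance : PartialOrder (CyclicHeight a m) :=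
  PartialOrder.lift CyclicHeight.val fun _ _ h => CyclicHeight.ext h

theorem le_iff {c e : CyclicHeight a m} : c ≤ e ↔ ∀ x y, c.val x y ≤ e.val x y := Iff.rfl

instance : Lattice (CyclicHeight a m) where
  sup c e :=
    { val := fun x y => max (c.val x y) (e.val x y)
      right_le := fun x y => max_le_max (c.right_le x y) (e.right_le x y)
      up_le := fun x y => max_le_max (c.up_le x y) (e.up_le x y)
      le_diag := fun x y => by have := c.le_diag x y; have := e.le_diag x y; omega
      glue := fun x => by rw [c.glue, e.glue]
      vanish := by rw [c.vanish, e.vanish, max_self] }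
  inf c e :=
    { val := fun x y => min (c.val x y) (e.val x y)
      right_le := fun x y => min_le_min (c.right_le x y) (e.right_le x y)
      up_le := fun x y => min_le_min (c.up_le x y) (e.up_le x y)
      le_diag := fun x y => by have := c.le_diag x y; have := e.le_diag x y; omega
      glue := fun x => by rw [c.glue, e.glue]
      vanish := by rw [c.vanish, e.vanish, min_self] }
  le_sup_left c e := fun x y => le_max_left _ _
  le_sup_right c e := fun x y => le_max_right _ _
  sup_le c e f h₁ h₂ := fun x y => max_le (h₁ x y) (h₂ x y)
  inf_le_left c e := fun x y => min_le_left _ _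
  inf_le_right c e := fun x y => min_le_right _ _
  le_inf c e f h₁ h₂ := fun x y => le_min (h₁ x y) (h₂ x y)

theorem sup_val (c e : CyclicHeight a m) (x y : ℕ) :
    (c ⊔ e).val x y = max (c.val x y) (e.val x y) := rfl

instance : OrderBot (CyclicHeight a m) where
  bot := ⟨fun _ _ => 0, by simp, by simp, by simp, by simp, rfl⟩
  bot_le _ := fun _ _ => Nat.zero_le _

theorem bot_val (x y : ℕ) : (⊥ : CyclicHeight a m).val x y = 0 := rfl

variable (c : CyclicHeight a m)

theorem antitone_left (y : ℕ) : Antitone fun x => c.val x y :=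
  antitone_nat_of_succ_le fun x => c.right_le x y

theorem antitone_right (x : ℕ) : Antitone (c.val x) :=
  antitone_nat_of_succ_le fun y => c.up_le x y

theorem val_anti {x y x' y' : ℕ} (hx : x ≤ x') (hy : y ≤ y') : c.val x' y' ≤ c.val x y :=
  (c.antitone_left y' hx).trans (c.antitone_right x hy)

theorem le_diag_add (x y k : ℕ) : c.val x y ≤ c.val (x + k) (y + k) + k := by
  induction k with
  | zero => simp
  | succ k ih => have := c.le_diag (x + k) (y + k); grind

theorem eq_zero_of_le_left {x : ℕ} (y : ℕ) (hx : a ≤ x) : c.val x y = 0 := by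
  have := c.val_anti hx (Nat.zero_le y)
  rw [c.vanish] at this
  omega

theorem eq_zero_of_le_right (x : ℕ) {y : ℕ} (hy : a + m ≤ y) : c.val x y = 0 := by
  have h := c.val_anti (Nat.zero_le x) (le_refl y)
  have h2 := c.glue (y - m)
  rw [Nat.sub_add_cancel (by omega), c.eq_zero_of_le_left 0 (by omega)] at h2
  omega

theorem le_sub_left (x y : ℕ) : c.val x y ≤ a - x := by
  have h := c.le_diag_add x y (a - x)
  rw [c.eq_zero_of_le_left _ (show a ≤ x + (a - x) by omega)] at h
  omega

theorem le_sub_right (x y : ℕ) : c.val x y ≤ a + m - y := by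
  have h := c.le_diag_add x y (a + m - y)
  rw [c.eq_zero_of_le_right _ (show a + m ≤ y + (a + m - y) by omega)] at h
  omega

theorem eq_of_le_m {y : ℕ} (hy : y ≤ m) : c.val 0 y = c.val 0 0 := by
  have h := c.glue 0
  have h₁ := c.antitone_right 0 hy
  have h₂ := c.antitone_right 0 (Nat.zero_le y)
  rw [Nat.zero_add] at h
  omega

theorem ext_val {c e : CyclicHeight a m} (h : ∀ x y, c.val x y = e.val x y) : c = e :=
  CyclicHeight.ext (funext₂ h)

instance : Finite (CyclicHeight a m) := by
  let f : CyclicHeight a m → Fin a → Fin (a + m) → Fin (a + 1) :=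
    fun c x y => ⟨c.val x y, by have := c.le_sub_left x y; omega⟩
  refine Finite.of_injective f fun c e h => ext_val fun x y => ?_
  by_cases hx : a ≤ x
  · rw [c.eq_zero_of_le_left y hx, e.eq_zero_of_le_left y hx]
  by_cases hy : a + m ≤ y
  · rw [c.eq_zero_of_le_right x hy, e.eq_zero_of_le_right x hy]
  have := congrFun (congrFun h ⟨x, by omega⟩) ⟨y, by omega⟩
  simpa [f] using this

/-- If `i` paths do not exhaust those entering the line `x` at height at least `y`, then path
number `i` enters this line at a well-defined height. -/
theorem exists_top {i x y : ℕ} (h : i < c.val x y) :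
    ∃ v, y ≤ v ∧ c.val x (v + 1) ≤ i ∧ i < c.val x v := by
  have hex : ∃ v, c.val x (v + 1) ≤ i :=
    ⟨a + m, by rw [c.eq_zero_of_le_right x (by omega)]; omega⟩
  classical
  have h₁ := Nat.find_spec hex
  have hy : y ≤ Nat.find hex := by
    by_contra hlt
    have := c.antitone_right x (show Nat.find hex + 1 ≤ y by omega)
    omega
  refine ⟨Nat.find hex, hy, h₁, ?_⟩
  rcases Nat.eq_zero_or_pos (Nat.find hex) with h0 | hpos
  · rw [h0] at hy ⊢
    rwa [Nat.le_zero.mp hy] at h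
  · have h2 := Nat.find_min hex (show Nat.find hex - 1 < Nat.find hex by omega)
    rw [show Nat.find hex - 1 + 1 = Nat.find hex by omega] at h2
    omega

theorem top_unique {i x v w : ℕ} (h₁ : c.val x (v + 1) ≤ i) (h₂ : i < c.val x v)
    (h₃ : c.val x (w + 1) ≤ i) (h₄ : i < c.val x w) : v = w := by
  by_contra hne
  rcases Nat.lt_or_gt_of_ne hne with h | h
  · have := c.antitone_right x (show v + 1 ≤ w by omega); omega
  · have := c.antitone_right x (show w + 1 ≤ v by omega); omega

/-- The height function of the tiling reflected in the horizontal symmetry axis.  On the part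
`y ≤ x + m` of the parallelogram the reflection maps each vertical line to itself; the
remaining part is mapped to another rotated copy of the parallelogram, whence the second formula. -/
def reflect : CyclicHeight a m where
  val x y := if y ≤ x + m then a - x - c.val x (x + m - y) else a + m - y - c.val (y - x - m) y
  right_le x y := by
    have h₁ := c.le_diag x (x + m - y)
    have h₂ := c.right_le (y - x - m - 1) y
    split_ifs with h h' h'
    · rw [show x + 1 + m - y = x + m - y + 1 by omega]; omega
    · obtain rfl : y = x + m + 1 := by omega
      rw [show x + m + 1 - x - m - 1 = 0 by omega, zero_add] at h₂
      rw [show x + m + 1 - x - m = 1 by omega]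
      rw [show x + 1 + m - (x + m + 1) = 0 by omega]
      have hg := c.glue (x + 1)
      rw [show x + 1 + m = x + m + 1 by omega] at hg
      omega
    · omega
    · rw [show y - x - m - 1 + 1 = y - x - m by omega] at h₂
      rw [show y - (x + 1) - m = y - x - m - 1 by omega]; omega
  up_le x y := by
    have h₁ := c.up_le x (x + m - y - 1)
    have h₂ := c.le_diag (y - x - m) y
    split_ifs with h h' h'
    · rw [show x + m - y - 1 + 1 = x + m - y by omega] at h₁
      rw [show x + m - (y + 1) = x + m - y - 1 by omega]; omega
    · omega
    · obtain rfl : y = x + m := by omega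
      rw [show x + m - x - m = 0 by omega] at h₂
      rw [show x + m + 1 - x - m = 1 by omega]
      rw [show x + m - (x + m) = 0 by omega]
      have := c.glue x
      have := c.le_sub_left x 0
      have := c.le_sub_right 1 (x + m + 1)
      rw [zero_add] at h₂
      omega
    · have := c.le_sub_right (y - x - m) y
      rw [show y + 1 - x - m = y - x - m + 1 by omega]; omega
  le_diag x y := by
    have h₁ := c.right_le x (x + m - y)
    have h₂ := c.up_le (y - x - m) y
    rw [show x + 1 + m - (y + 1) = x + m - y by omega,
      show y + 1 - (x + 1) - m = y - x - m by omega]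
    split_ifs <;> omega
  glue x := by
    have := c.glue x
    split_ifs with h h' h' <;> try omega
    · obtain rfl : x = 0 := by omega
      simp_all
    · rw [Nat.sub_zero, Nat.add_sub_cancel]
      omega
  vanish := by simp

theorem reflect_val_of_le {x y : ℕ} (h : y ≤ x + m) :
    c.reflect.val x y = a - x - c.val x (x + m - y) := by simp [reflect, h]

theorem reflect_val_of_ge {x y : ℕ} (h : x + m ≤ y) :
    c.reflect.val x y = a + m - y - c.val (y - x - m) y := by
  rcases eq_or_lt_of_le h with rfl | h
  · have := c.glue x
    rw [c.reflect_val_of_le le_rfl, show x + m - (x + m) = 0 by omega,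
      show x + m - x - m = 0 by omega]
    omega
  · simp [reflect, show ¬ y ≤ x + m by omega]

theorem reflect_reflect : c.reflect.reflect = c := by
  refine ext_val fun x y => ?_
  rcases le_total y (x + m) with h | h
  · rw [reflect_val_of_le _ h, reflect_val_of_le _ (by omega),
      show x + m - (x + m - y) = y by omega]
    have := c.le_sub_left x y
    omega
  · rw [reflect_val_of_ge _ h, reflect_val_of_ge _ (by omega),
      show y - (y - x - m) - m = x by omega]
    have := c.le_sub_right x y
    omega

theorem reflect_le_reflect {c e : CyclicHeight a m} (h : c ≤ e) : e.reflect ≤ c.reflect := by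
  intro x y
  rcases le_total y (x + m) with h' | h'
  · rw [reflect_val_of_le _ h', reflect_val_of_le _ h']
    exact Nat.sub_le_sub_left (h _ _) _
  · rw [reflect_val_of_ge _ h', reflect_val_of_ge _ h']
    exact Nat.sub_le_sub_left (h _ _) _

/-- Reflection as an antiautomorphism of the lattice of cyclic height functions. -/
def reflectIso : CyclicHeight a m ≃o (CyclicHeight a m)ᵒᵈ where
  toFun c := OrderDual.toDual c.reflect
  invFun c := (OrderDual.ofDual c).reflect
  left_inv c := c.reflect_reflect
  right_inv c := (OrderDual.ofDual c).reflect_reflect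
  map_rel_iff' {c e} := by
    refine ⟨fun h => ?_, fun h => reflect_le_reflect h⟩
    have := reflect_le_reflect (show e.reflect ≤ c.reflect from h)
    rwa [reflect_reflect, reflect_reflect] at this

end CyclicHeight

/-! ### Lists given by their entries -/

theorem exists_lt_iff {P : ℕ → Prop} (h : ∀ i, P (i + 1) → P i) {N : ℕ} (hN : ¬ P N) :
    ∃ k, ∀ i, i < k ↔ P i := by
  classical
  have hex : ∃ k, ¬ P k := ⟨N, hN⟩
  have hanti : ∀ i k, P (i + k) → P i := by
    intro i k
    induction k with
    | zero => exact id
    | succ k ih => exact fun hk => ih (h _ hk)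
  refine ⟨Nat.find hex, fun i => ⟨fun hi => not_not.mp (Nat.find_min hex hi), fun hi => ?_⟩⟩
  by_contra hle
  refine Nat.find_spec hex (hanti _ (i - Nat.find hex) ?_)
  rwa [Nat.add_sub_cancel' (not_lt.mp hle)]

theorem List.eq_of_getElem?_eq_some_iff {β : Type*} {w w' : List β}
    (h : ∀ (j : ℕ) (v : β), w[j]? = some v ↔ w'[j]? = some v) : w = w' :=
  List.ext_getElem? fun j => Option.ext fun v => h j v

theorem List.lt_length_iff_exists {β : Type*} (w : List β) (j : ℕ) :
    j < w.length ↔ ∃ v, w[j]? = some v := by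
  rw [← Option.isSome_iff_exists]
  simp

theorem exists_list {β : Type*} {R : ℕ → β → Prop} (huniq : ∀ j v w, R j v → R j w → v = w)
    (hdown : ∀ j v, R (j + 1) v → ∃ u, R j u) {N : ℕ} (hN : ∀ v, ¬ R N v) :
    ∃ w : List β, ∀ j v, w[j]? = some v ↔ R j v := by
  obtain ⟨L, hL⟩ := exists_lt_iff (P := fun j => ∃ v, R j v) (fun j ⟨v, hv⟩ => hdown j v hv)
    (N := N) (fun ⟨v, hv⟩ => hN v hv)
  refine ⟨List.ofFn fun j : Fin L => ((hL j).1 j.2).choose, fun j v => ?_⟩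
  by_cases hj : j < L
  · simp only [List.getElem?_ofFn, hj, dite_true, Option.some.injEq]
    have hs := ((hL j).1 hj).choose_spec
    exact ⟨fun h => h ▸ hs, fun h => huniq _ _ _ hs h⟩
  · simp only [List.getElem?_ofFn, hj, dite_false]
    exact ⟨fun h => by simp at h, fun h => absurd ((hL j).2 ⟨v, h⟩) hj⟩

theorem arrayEntry_eq_some {rows : List (List ℕ)} {i j v : ℕ} :
    arrayEntry rows i j = some v ↔ i ≤ j ∧ ∃ r, rows[i]? = some r ∧ r[j - i]? = some v := by
  unfold arrayEntry
  split_ifs with h <;> simp [h, Option.bind_eq_some_iff]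

/-! ### Descending plane partitions and cyclic height functions -/

namespace CyclicHeight

variable {a m : ℕ}

/-- The list `r` consists of the heights at which path number `i` enters the vertical lines
`0, 1, 2, …`, where heights `0` are dropped if `m ≠ 0`. -/
def RowSpec (c : CyclicHeight a m) (i : ℕ) (r : List ℕ) : Prop :=
  ∀ j v, r[j]? = some v ↔ c.val j (v + 1) ≤ i ∧ i < c.val j v ∧ (m = 0 ∨ 0 < v)

theorem RowSpec.unique {c : CyclicHeight a m} {i : ℕ} {r s : List ℕ} (hr : c.RowSpec i r)
    (hs : c.RowSpec i s) : r = s :=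
  List.eq_of_getElem?_eq_some_iff fun j v => (hr j v).trans (hs j v).symm

theorem exists_rowSpec (c : CyclicHeight a m) (i : ℕ) : ∃ r, c.RowSpec i r := by
  refine exists_list (N := a) ?_ ?_ ?_
  · rintro j v w ⟨h₁, h₂, -⟩ ⟨h₃, h₄, -⟩
    exact c.top_unique h₁ h₂ h₃ h₄
  · rintro j v ⟨-, h₂, h₃⟩
    obtain ⟨u, hu, h₄, h₅⟩ := c.exists_top (h₂.trans_le (c.right_le j v))
    exact ⟨u, h₄, h₅, by omega⟩
  · rintro v ⟨-, h, -⟩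
    rw [c.eq_zero_of_le_left v le_rfl] at h
    omega

theorem RowSpec.lt_length_iff {c : CyclicHeight a m} {i : ℕ} {r : List ℕ} (hr : c.RowSpec i r)
    (x : ℕ) : x < r.length ↔ i < c.val x (min m 1) := by
  rw [List.lt_length_iff_exists]
  constructor
  · rintro ⟨v, hv⟩
    obtain ⟨-, h, h'⟩ := (hr x v).1 hv
    exact h.trans_le (c.antitone_right x (by omega))
  · intro h
    obtain ⟨v, hv, h₁, h₂⟩ := c.exists_top h
    exact ⟨v, (hr x v).2 ⟨h₁, h₂, by omega⟩⟩

theorem RowSpec.length_pos {c : CyclicHeight a m} {i : ℕ} {r : List ℕ} (hr : c.RowSpec i r)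
    (hi : i < c.val 0 0) : 0 < r.length := by
  rw [hr.lt_length_iff, c.eq_of_le_m (by omega)]
  exact hi

/-- The starting height of path number `i` is `x + m`, where `x` is the line on which
the path ends. -/
theorem RowSpec.head {c : CyclicHeight a m} {i : ℕ} {r : List ℕ} (hr : c.RowSpec i r) {v : ℕ}
    (hv : r.head? = some v) : ∃ x, v = x + m ∧ i < c.val x 0 ∧ c.val (x + 1) 0 ≤ i := by
  rw [List.head?_eq_getElem?, hr] at hv
  obtain ⟨h₁, h₂, -⟩ := hv
  have hm : m ≤ v := by
    by_contra h
    have h₃ := c.eq_of_le_m (show v + 1 ≤ m by omega)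
    have h₄ := c.antitone_right 0 (Nat.zero_le v)
    omega
  obtain ⟨x, rfl⟩ := Nat.exists_eq_add_of_le' hm
  have h₃ := c.glue (x + 1)
  rw [show x + 1 + m = x + m + 1 by omega] at h₃
  rw [c.glue] at h₂
  exact ⟨x, rfl, h₂, by omega⟩

end CyclicHeight

namespace DescendingPP

variable {d : ℤ} {n a m : ℕ}

/-- The entries of `π` are the heights at which the paths with height function `c` enter the
vertical lines. -/
def Matches (π : DescendingPP d n) (c : CyclicHeight a m) : Prop :=
  ∀ i x v, (∃ r, π.rows[i]? = some r ∧ r[x]? = some v) ↔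
    c.val x (v + 1) ≤ i ∧ i < c.val x v ∧ (m = 0 ∨ 0 < v)

theorem exists_matches_of_height (ha : (n : ℤ) + d - 1 = a) (hm : 2 - d = m)
    (c : CyclicHeight a m) : ∃ π : DescendingPP d n, π.Matches c := by
  obtain ⟨rows, hrows⟩ : ∃ rows : List (List ℕ), ∀ i r,
      rows[i]? = some r ↔ i < c.val 0 0 ∧ c.RowSpec i r := by
    refine exists_list (N := c.val 0 0) (fun i r s hr hs => hr.2.unique hs.2) ?_ ?_
    · rintro i r ⟨hi, -⟩
      obtain ⟨s, hs⟩ := c.exists_rowSpec i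
      exact ⟨s, by omega, hs⟩
    · rintro r ⟨hi, -⟩
      omega
  have hmem : ∀ r ∈ rows, ∃ i, i < c.val 0 0 ∧ c.RowSpec i r := by
    intro r hr
    obtain ⟨i, hi⟩ := List.mem_iff_getElem?.1 hr
    exact ⟨i, (hrows i r).1 hi⟩
  have hentry : ∀ i j v, arrayEntry rows i j = some v →
      i ≤ j ∧ c.val (j - i) (v + 1) ≤ i ∧ i < c.val (j - i) v := by
    intro i j v h
    obtain ⟨hij, r, hr, hv⟩ := arrayEntry_eq_some.1 h
    have := (((hrows i r).1 hr).2 _ _).1 hv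
    exact ⟨hij, this.1, this.2.1⟩
  refine ⟨⟨rows, ?_, ?_, ?_, ?_, ?_, ?_, ?_, ?_, ?_⟩, ?_⟩
  · intro r hr
    obtain ⟨i, hi, h⟩ := hmem r hr
    exact List.ne_nil_of_length_pos (h.length_pos hi)
  · intro i r s hr hs
    obtain ⟨hi, hr⟩ := (hrows i r).1 hr
    obtain ⟨hi', hs⟩ := (hrows _ s).1 hs
    have h₁ := hs.length_pos hi'
    have h₂ := (hs.lt_length_iff (s.length - 1)).1 (by omega)
    have h₃ := c.le_diag (s.length - 1) (min m 1)
    have h₄ := c.up_le (s.length - 1 + 1) (min m 1)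
    have h₅ := (hr.lt_length_iff (s.length - 1 + 1)).2 (by omega)
    omega
  · intro r hr v hv
    obtain ⟨i, hi, h⟩ := hmem r hr
    obtain ⟨j, hj⟩ := List.mem_iff_getElem?.1 hv
    obtain ⟨-, h₂, -⟩ := (h j v).1 hj
    by_contra hlt
    rw [c.eq_zero_of_le_right j (by omega)] at h₂
    omega
  · intro hd r hr v hv
    obtain ⟨i, hi, h⟩ := hmem r hr
    obtain ⟨j, hj⟩ := List.mem_iff_getElem?.1 hv
    have := ((h j v).1 hj).2.2
    omega
  · intro i j v w hv hw
    obtain ⟨hij, h₁, h₂⟩ := hentry _ _ _ hv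
    obtain ⟨-, h₃, h₄⟩ := hentry _ _ _ hw
    by_contra hlt
    have := c.val_anti (show j - i ≤ j + 1 - i by omega) (show v + 1 ≤ w by omega)
    omega
  · intro i j v w hv hw
    obtain ⟨hij, h₁, h₂⟩ := hentry _ _ _ hv
    obtain ⟨hij', h₃, h₄⟩ := hentry _ _ _ hw
    by_contra hlt
    have h₅ := c.le_diag (j - (i + 1)) w
    rw [show j - (i + 1) + 1 = j - i by omega] at h₅
    have := c.antitone_right (j - i) (show v + 1 ≤ w + 1 by omega)
    omega
  · intro i r s v hr hs hv
    obtain ⟨hi, hr⟩ := (hrows i r).1 hr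
    obtain ⟨hi', hs⟩ := (hrows _ s).1 hs
    obtain ⟨x, rfl, h₁, h₂⟩ := hs.head hv
    have h₃ := c.le_diag x 0
    have h₄ := c.antitone_right (x + 1) (show min m 1 ≤ 0 + 1 by omega)
    have h₅ := (hr.lt_length_iff (x + 1)).2 (by omega)
    omega
  · intro r hr v hv
    obtain ⟨i, hi, hr⟩ := hmem r hr
    obtain ⟨x, rfl, h₁, h₂⟩ := hr.head hv
    have h₄ := c.antitone_right (x + 1) (Nat.zero_le (min m 1))
    have h₅ := (hr.lt_length_iff (x + 1)).not.2 (by omega)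
    omega
  · intro hd r hr v hv
    obtain ⟨i, hi, hr⟩ := hmem r hr
    obtain ⟨x, rfl, h₁, h₂⟩ := hr.head hv
    have h0 : min m 1 = 0 := by omega
    have h₄ := (hr.lt_length_iff (x + 1)).not.2 (by rw [h0]; omega)
    have h₅ := (hr.lt_length_iff x).2 (by rwa [h0])
    omega
  · intro i x v
    constructor
    · rintro ⟨r, hr, hv⟩
      exact (((hrows i r).1 hr).2 x v).1 hv
    · intro h
      obtain ⟨r, hr⟩ := c.exists_rowSpec i
      exact ⟨r, (hrows i r).2 ⟨h.2.1.trans_le (c.val_anti (Nat.zero_le _) (Nat.zero_le _)), hr⟩,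
        (hr x v).2 h⟩

/-- Row `i` of `π` has an entry at least `y` in place `x`. -/
def Reaches (π : DescendingPP d n) (i x y : ℕ) : Prop :=
  ∃ r v, π.rows[i]? = some r ∧ r[x]? = some v ∧ y ≤ v

namespace Reaches

variable {π : DescendingPP d n} {i x y : ℕ}

theorem mono {y' : ℕ} (h : π.Reaches i x y) (hy : y' ≤ y) : π.Reaches i x y' := by
  obtain ⟨r, v, hr, hv, hyv⟩ := h
  exact ⟨r, v, hr, hv, hy.trans hyv⟩

theorem left (h : π.Reaches i (x + 1) y) : π.Reaches i x y := by
  obtain ⟨r, v, hr, hv, hyv⟩ := h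
  obtain ⟨w, hw⟩ := (r.lt_length_iff_exists x).1
    (by have := (r.lt_length_iff_exists (x + 1)).2 ⟨v, hv⟩; omega)
  refine ⟨r, w, hr, hw, hyv.trans ?_⟩
  refine π.rows_weak i (i + x) w v (arrayEntry_eq_some.2 ⟨by omega, r, hr, ?_⟩)
    (arrayEntry_eq_some.2 ⟨by omega, r, hr, ?_⟩)
  · rwa [Nat.add_sub_cancel_left]
  · rwa [show i + x + 1 - i = x + 1 by omega]

theorem up (h : π.Reaches (i + 1) x y) : π.Reaches i (x + 1) (y + 1) := by
  obtain ⟨s, v, hs, hv, hyv⟩ := h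
  have hi : i < π.rows.length := by
    have := (π.rows.lt_length_iff_exists (i + 1)).2 ⟨s, hs⟩
    omega
  obtain ⟨r, hr⟩ := (π.rows.lt_length_iff_exists i).1 hi
  have := π.shape i r s hr hs
  obtain ⟨w, hw⟩ := (r.lt_length_iff_exists (x + 1)).1
    (by have := (s.lt_length_iff_exists x).2 ⟨v, hv⟩; omega)
  refine ⟨r, w, hr, hw, Nat.succ_le_of_lt (hyv.trans_lt ?_)⟩
  refine π.cols_strict i (i + 1 + x) w v (arrayEntry_eq_some.2 ⟨by omega, r, hr, ?_⟩)
    (arrayEntry_eq_some.2 ⟨by omega, s, hs, ?_⟩)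
  · rwa [show i + 1 + x - i = x + 1 by omega]
  · rwa [Nat.add_sub_cancel_left]

theorem of_succ (h : π.Reaches (i + 1) x y) : π.Reaches i x y :=
  h.up.left.mono (by omega)

end Reaches

theorem reaches_start_iff (π : DescendingPP d n) {i x : ℕ} {r : List ℕ}
    (hr : π.rows[i]? = some r) :
    π.Reaches i 0 (x + m) ↔ ∃ v, r.head? = some v ∧ x + m ≤ v := by
  constructor
  · rintro ⟨s, v, hs, hv, hle⟩
    obtain rfl : s = r := Option.some.inj (hs.symm.trans hr)
    exact ⟨v, by rwa [List.head?_eq_getElem?], hle⟩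
  · rintro ⟨v, hv, hle⟩
    exact ⟨r, v, hr, by rwa [← List.head?_eq_getElem?], hle⟩

theorem reaches_start (hm : 2 - d = m) {π : DescendingPP d n} {i x : ℕ}
    (h : π.Reaches i x (min m 1)) : π.Reaches i 0 (x + m) := by
  obtain ⟨r, v, hr, hv, hle⟩ := h
  have hx : x < r.length := (r.lt_length_iff_exists x).2 ⟨v, hv⟩
  obtain ⟨u, hu⟩ := (r.lt_length_iff_exists 0).1 (by omega)
  rw [← List.head?_eq_getElem?] at hu
  rw [reaches_start_iff π hr]
  have := π.lt_first r (List.mem_of_getElem? hr) u hu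
  have := π.first_eq
  refine ⟨u, hu, ?_⟩
  omega

theorem reaches_zero_of_start (hm : 2 - d = m) (hm0 : m = 0) {π : DescendingPP d n} {i x : ℕ}
    (h : π.Reaches i 0 x) : π.Reaches i x 0 := by
  obtain ⟨r, v, hr, hv, hle⟩ := h
  rw [← List.head?_eq_getElem?] at hv
  have := π.first_eq (by omega) r (List.mem_of_getElem? hr) v hv
  obtain ⟨w, hw⟩ := (r.lt_length_iff_exists x).1 (by omega)
  exact ⟨r, w, hr, hw, Nat.zero_le w⟩

/-- For a path that starts at height at least `x + m`, the path before it is still at positive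
height when it enters the line `x + 1`. -/
theorem reaches_succ_of_start (hm : 2 - d = m) {π : DescendingPP d n} {i x : ℕ}
    (h : π.Reaches (i + 1) 0 (x + m)) : π.Reaches i (x + 1) 1 := by
  by_cases hm0 : m = 0
  · exact (reaches_zero_of_start hm hm0 (by simpa [hm0] using h)).up
  obtain ⟨r, hr⟩ : ∃ r, π.rows[i]? = some r := by
    obtain ⟨r, -, hr, -⟩ := h.of_succ
    exact ⟨r, hr⟩
  obtain ⟨s, v, hs, hv, hle⟩ := h
  rw [← List.head?_eq_getElem?] at hv
  have := π.first_le i r s v hr hs hv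
  obtain ⟨w, hw⟩ := (r.lt_length_iff_exists (x + 1)).1 (by omega)
  exact ⟨r, w, hr, hw,
    π.entry_pos (by omega) r (List.mem_of_getElem? hr) w (List.mem_of_getElem? hw)⟩

theorem exists_height_matches (ha : (n : ℤ) + d - 1 = a) (hm : 2 - d = m)
    (π : DescendingPP d n) : ∃ c : CyclicHeight a m, π.Matches c := by
  -- At height `0` a path may have no entry although it is present on the line `x`; there the
  -- starting height tells how far the path extends.
  have hex : ∀ x y, ∃ k, ∀ i, i < k ↔ if y = 0 then π.Reaches i 0 (x + m) else π.Reaches i x y := by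
    intro x y
    refine exists_lt_iff (N := π.rows.length) (fun i => ?_) ?_
    · split_ifs <;> exact fun h => h.of_succ
    · split_ifs <;>
      · rintro ⟨r, v, hr, -⟩
        simp at hr
  choose c hc using hex
  have hle : ∀ {x y x' y'}, (∀ i, i < c x y → i < c x' y') → c x y ≤ c x' y' :=
    fun h => not_lt.mp fun hlt => lt_irrefl _ (h _ hlt)
  have hc0 : ∀ x i, i < c x 0 ↔ π.Reaches i 0 (x + m) := fun x i => by simp [hc]
  have hc1 : ∀ x y i, y ≠ 0 → (i < c x y ↔ π.Reaches i x y) := fun x y i h => by simp [hc, h]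
  have hc2 : ∀ x y i, m = 0 → (i < c x y ↔ π.Reaches i x y) := by
    intro x y i h
    rcases eq_or_ne y 0 with rfl | hy
    · rw [hc0]
      refine ⟨fun h' => reaches_zero_of_start hm h (by simpa [h] using h'), fun h' => ?_⟩
      exact reaches_start hm (by simpa [h] using h')
    · exact hc1 x y i hy
  refine ⟨⟨c, fun x y => hle fun i => ?_, fun x y => hle fun i => ?_, fun x y => ?_, fun x => ?_,
    ?_⟩, fun i x v => ?_⟩
  · rcases eq_or_ne y 0 with rfl | hy
    · rw [hc0, hc0]
      exact fun h => h.mono (by omega)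
    · rw [hc1 _ _ _ hy, hc1 _ _ _ hy]
      exact fun h => h.left
  · rw [hc1 _ _ _ (by omega)]
    rcases eq_or_ne y 0 with rfl | hy
    · rw [hc0]
      exact fun h => reaches_start hm (h.mono (by omega))
    · rw [hc1 _ _ _ hy]
      exact fun h => h.mono (by omega)
  · have key : ∀ i, i + 1 < c x y → i < c (x + 1) (y + 1) := by
      intro i
      rw [hc1 _ (y + 1) _ (by omega)]
      rcases eq_or_ne y 0 with rfl | hy
      · rw [hc0]
        exact fun h => reaches_succ_of_start hm h
      · rw [hc1 _ _ _ hy]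
        exact fun h => h.up
    have := key (c x y - 2)
    have := key (c (x + 1) (y + 1))
    omega
  · rcases eq_or_ne (x + m) 0 with h | h
    · rw [h, show x = 0 by omega]
    · refine le_antisymm (hle fun i => ?_) (hle fun i => ?_) <;> rw [hc0, hc1 _ _ _ h] <;> exact id
  · refine Nat.eq_zero_of_le_zero (not_lt.mp fun h => ?_)
    obtain ⟨r, v, hr, hv, hle⟩ := (hc0 a 0).1 h
    have := π.entry_le r (List.mem_of_getElem? hr) v (List.mem_of_getElem? hv)
    omega
  · have hs : ∀ (y : ℕ), m = 0 ∨ 0 < y → (i < c x y ↔ π.Reaches i x y) := fun y hy =>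
      hy.elim (hc2 x y i) fun hy => hc1 x y i hy.ne'
    change _ ↔ c x (v + 1) ≤ i ∧ i < c x v ∧ _
    constructor
    · rintro ⟨r, hr, hv⟩
      have hpos : m = 0 ∨ 0 < v := by
        by_cases h : d = 2
        · left; omega
        · exact Or.inr (π.entry_pos h r (List.mem_of_getElem? hr) v (List.mem_of_getElem? hv))
      refine ⟨not_lt.mp fun h => ?_, (hs v hpos).2 ⟨r, v, hr, hv, le_rfl⟩, hpos⟩
      obtain ⟨r', w, hr', hw, hle⟩ := (hs (v + 1) (by omega)).1 h
      obtain rfl : r' = r := Option.some.inj (hr'.symm.trans hr)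
      obtain rfl : w = v := Option.some.inj (hw.symm.trans hv)
      omega
    · rintro ⟨h₁, h₂, h₃⟩
      obtain ⟨r, w, hr, hw, hle⟩ := (hs v h₃).1 h₂
      have h₄ : ¬ v + 1 ≤ w := fun h =>
        absurd ((hs (v + 1) (by omega)).2 ⟨r, w, hr, hw, h⟩) (not_lt.mpr h₁)
      obtain rfl : w = v := by omega
      exact ⟨r, hr, hw⟩

theorem Matches.le_iff {π σ : DescendingPP d n} {c e : CyclicHeight a m} (hπ : π.Matches c)
    (hσ : σ.Matches e) : π ≤ σ ↔ c ≤ e := by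
  constructor
  · intro h
    have key : ∀ x y, m = 0 ∨ 0 < y → c.val x y ≤ e.val x y := by
      refine fun x y hy => not_lt.mp fun hlt => ?_
      obtain ⟨v, hv, h₁, h₂⟩ := c.exists_top hlt
      obtain ⟨r, hr, hv'⟩ := (hπ _ x v).2 ⟨h₁, h₂, by omega⟩
      obtain ⟨w, hw, hvw⟩ := h (e.val x y) (e.val x y + x) v
        (arrayEntry_eq_some.2 ⟨by omega, r, hr, by rwa [Nat.add_sub_cancel_left]⟩)
      obtain ⟨-, s, hs, hw⟩ := arrayEntry_eq_some.1 hw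
      rw [Nat.add_sub_cancel_left] at hw
      obtain ⟨-, h₃, -⟩ := (hσ _ x w).1 ⟨s, hs, hw⟩
      have := e.antitone_right x (hv.trans hvw)
      omega
    intro x y
    by_cases hy : m = 0 ∨ 0 < y
    · exact key x y hy
    · obtain rfl : y = 0 := by omega
      have := key 0 (x + m) (by omega)
      rwa [c.glue, e.glue] at this
  · intro h i j v hv
    obtain ⟨hij, r, hr, hv⟩ := arrayEntry_eq_some.1 hv
    obtain ⟨-, h₁, h₂⟩ := (hπ i _ v).1 ⟨r, hr, hv⟩
    obtain ⟨w, hw, h₃, h₄⟩ := e.exists_top (h₁.trans_le (h (j - i) v))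
    obtain ⟨s, hs, hw'⟩ := (hσ i _ w).2 ⟨h₃, h₄, by omega⟩
    exact ⟨w, arrayEntry_eq_some.2 ⟨hij, s, hs, hw'⟩, hw⟩

/-- Descending plane partitions correspond to cyclic height functions, as ordered sets. -/
theorem exists_orderIso_matches (ha : (n : ℤ) + d - 1 = a) (hm : 2 - d = m) :
    ∃ e : DescendingPP d n ≃o CyclicHeight a m, ∀ π : DescendingPP d n, π.Matches (e π) := by
  choose f hf using exists_height_matches (n := n) ha hm
  choose g hg using exists_matches_of_height (n := n) ha hm
  exact ⟨{ toFun := f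
           invFun := g
           left_inv := fun π => le_antisymm (((hg _).le_iff (hf π)).2 le_rfl)
             (((hf π).le_iff (hg _)).2 le_rfl)
           right_inv := fun c => le_antisymm (((hf _).le_iff (hg c)).1 le_rfl)
             (((hg c).le_iff (hf _)).1 le_rfl)
           map_rel_iff' := fun {π σ} => ((hf π).le_iff (hf σ)).symm }, hf⟩

/-- The rows of `π` are exactly the lists of heights of the paths. -/
theorem Matches.mem_rows_iff {π : DescendingPP d n} {c : CyclicHeight a m} (h : π.Matches c)
    (r : List ℕ) : r ∈ π.rows ↔ ∃ i, i < c.val 0 0 ∧ c.RowSpec i r := by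
  have hrow : ∀ {i s}, π.rows[i]? = some s → c.RowSpec i s := by
    intro i s hs j v
    rw [← h i j v]
    constructor
    · exact fun hv => ⟨s, hs, hv⟩
    · rintro ⟨s', hs', hv⟩
      obtain rfl : s' = s := Option.some.inj (hs'.symm.trans hs)
      exact hv
  constructor
  · intro hr
    obtain ⟨i, hi⟩ := List.mem_iff_getElem?.1 hr
    obtain ⟨v, hv⟩ := (r.lt_length_iff_exists 0).1
      (List.length_pos_of_ne_nil (π.row_ne_nil r hr))
    obtain ⟨-, h₁, -⟩ := (hrow hi 0 v).1 hv
    exact ⟨i, h₁.trans_le (c.antitone_right 0 (Nat.zero_le v)), hrow hi⟩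
  · rintro ⟨i, hi, hr⟩
    obtain ⟨v, hv⟩ := (r.lt_length_iff_exists 0).1 (hr.length_pos hi)
    obtain ⟨s, hs, -⟩ := (h i 0 v).2 ((hr 0 v).1 hv)
    rw [hr.unique (hrow hs)]
    exact List.mem_of_getElem? hs

end DescendingPP

/-! ### Rhombi and the rotation -/

namespace Rhombus

theorem rotate_mk (p q r : ℤ) (δ : Fin 3) :
    rotate ⟨![p, q, r], δ⟩ = ⟨![r, p, q], δ + 1⟩ := by
  refine Rhombus.ext ?_ (finRotate_apply δ)
  funext i
  fin_cases i <;> rfl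

theorem reflect_mk (p q r : ℤ) (δ : Fin 3) :
    reflect ⟨![p, q, r], δ⟩ = ⟨![p, r, q], Equiv.swap 1 2 δ⟩ := by
  refine Rhombus.ext ?_ rfl
  funext i
  fin_cases i <;> rfl

theorem exists_eq_mk (R : Rhombus) : ∃ p q r δ, R = ⟨![p, q, r], δ⟩ := by
  refine ⟨R.tri 0, R.tri 1, R.tri 2, R.dir, Rhombus.ext ?_ rfl⟩
  funext i
  fin_cases i <;> rfl

theorem rotate_rotate_rotate (R : Rhombus) : R.rotate.rotate.rotate = R := by
  obtain ⟨p, q, r, δ, rfl⟩ := R.exists_eq_mk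
  simp only [rotate_mk]
  congr 1
  fin_cases δ <;> rfl

theorem reflect_reflect (R : Rhombus) : R.reflect.reflect = R := by
  obtain ⟨p, q, r, δ, rfl⟩ := R.exists_eq_mk
  simp only [reflect_mk]
  congr 1
  fin_cases δ <;> rfl

theorem rotate_reflect_rotate (R : Rhombus) : R.rotate.reflect.rotate = R.reflect := by
  obtain ⟨p, q, r, δ, rfl⟩ := R.exists_eq_mk
  simp only [reflect_mk, rotate_mk]
  congr 1
  fin_cases δ <;> rfl

theorem rotate_injective : Function.Injective rotate := fun R S h => by
  rw [← R.rotate_rotate_rotate, h, S.rotate_rotate_rotate]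

theorem rotate_image_eq_iff {T : Set Rhombus} :
    rotate '' T = T ↔ ∀ R, R.rotate ∈ T ↔ R ∈ T := by
  constructor
  · intro h R
    conv_lhs => rw [← h]
    exact rotate_injective.mem_set_image
  · intro h
    ext R
    refine ⟨?_, fun hR => ⟨R.rotate.rotate, ?_, R.rotate_rotate_rotate⟩⟩
    · rintro ⟨S, hS, rfl⟩
      exact (h S).2 hS
    · rwa [h, h]

end Rhombus

theorem vec3_eq_iff {p q r p' q' r' : ℤ} :
    (![p, q, r] : Fin 3 → ℤ) = ![p', q', r'] ↔ p = p' ∧ q = q' ∧ r = r' := by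
  simp [funext_iff, Fin.forall_fin_succ]

theorem sum_vec3 (p q r : ℤ) : ∑ i, (![p, q, r] : Fin 3 → ℤ) i = p + q + r := by
  simp [Fin.sum_univ_three]

theorem Rhombus.mk_congr {p q r p' q' r' : ℤ} {δ : Fin 3} (hp : p = p') (hq : q = q')
    (hr : r = r') : (⟨![p, q, r], δ⟩ : Rhombus) = ⟨![p', q', r'], δ⟩ := by
  rw [hp, hq, hr]

theorem existsUnique_fin3 {P : Fin 3 → Prop} :
    (∃! δ, P δ) ↔ P 0 ∧ ¬ P 1 ∧ ¬ P 2 ∨ ¬ P 0 ∧ P 1 ∧ ¬ P 2 ∨ ¬ P 0 ∧ ¬ P 1 ∧ P 2 := by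
  simp only [ExistsUnique, Fin.exists_fin_succ, Fin.forall_fin_succ]
  simp
  tauto

theorem inHoleyHexagon_mk {a b p q r : ℤ} : InHoleyHexagon a b ![p, q, r] ↔
    (p + q + r = 2 * a + b - 1 ∨ p + q + r = 2 * a + b - 2) ∧
      (0 ≤ p ∧ p < a + b) ∧ (0 ≤ q ∧ q < a + b) ∧ (0 ≤ r ∧ r < a + b) ∧
      ¬ (a ≤ p ∧ a ≤ q ∧ a ≤ r) := by
  simp [InHoleyHexagon, Fin.sum_univ_three, Fin.forall_fin_succ, and_assoc]

/-- A set of rhombi is a tiling iff it defines a perfect matching between the unit triangles of the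
two orientations. -/
theorem isRhombusTiling_iff {a b : ℤ} {T : Set Rhombus} : IsRhombusTiling a b T ↔
    (∀ R ∈ T, ∑ i, R.tri i = 2 * a + b - 1 ∧ InHoleyHexagon a b R.tri ∧
      InHoleyHexagon a b (R.tri - Pi.single R.dir 1)) ∧
    (∀ t, InHoleyHexagon a b t → ∑ i, t i = 2 * a + b - 1 → ∃! δ, (⟨t, δ⟩ : Rhombus) ∈ T) ∧
    (∀ t, InHoleyHexagon a b t → ∑ i, t i = 2 * a + b - 2 →
      ∃! δ, (⟨t + Pi.single δ 1, δ⟩ : Rhombus) ∈ T) := by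
  have hsum : ∀ (t : Fin 3 → ℤ) (δ : Fin 3),
      ∑ i, (t + Pi.single δ 1 : Fin 3 → ℤ) i = ∑ i, t i + 1 := by
    intro t δ
    simp [Finset.sum_add_distrib]
  have hsum' : ∀ (t : Fin 3 → ℤ) (δ : Fin 3),
      ∑ i, (t - Pi.single δ 1 : Fin 3 → ℤ) i = ∑ i, t i - 1 := by
    intro t δ
    simp [Finset.sum_sub_distrib]
  have hcells : ∀ (R : Rhombus) (t : Fin 3 → ℤ), t ∈ R.cells ↔
      R = ⟨t, R.dir⟩ ∨ R = ⟨t + Pi.single R.dir 1, R.dir⟩ := by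
    intro R t
    simp only [Rhombus.cells, Set.mem_insert_iff, Set.mem_singleton_iff, Rhombus.ext_iff,
      and_true, eq_sub_iff_add_eq, eq_comm]
  have hup : ∀ R : Rhombus, (∀ t ∈ R.cells, InHoleyHexagon a b t) →
      ∑ i, R.tri i = 2 * a + b - 1 := by
    intro R h
    have h₁ := (h R.tri (by simp [Rhombus.cells])).1
    have h₂ := (h (R.tri - Pi.single R.dir 1) (by simp [Rhombus.cells])).1
    rw [hsum'] at h₂
    omega
  constructor
  · rintro ⟨h₁, h₂⟩
    refine ⟨fun R hR => ⟨hup R (h₁ R hR), h₁ R hR _ (by simp [Rhombus.cells]),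
      h₁ R hR _ (by simp [Rhombus.cells])⟩, fun t ht hs => ?_, fun t ht hs => ?_⟩
    · obtain ⟨R, ⟨hR, htR⟩, huniq⟩ := h₂ t ht
      rcases (hcells R t).1 htR with h | h
      · refine ⟨R.dir, by simpa only [← h] using hR, fun δ hδ => ?_⟩
        exact congrArg Rhombus.dir (huniq ⟨t, δ⟩ ⟨hδ, by simp [Rhombus.cells]⟩)
      · have := hup R (h₁ R hR)
        rw [h] at this
        simp only [hsum] at this
        omega
    · obtain ⟨R, ⟨hR, htR⟩, huniq⟩ := h₂ t ht
      rcases (hcells R t).1 htR with h | h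
      · have := hup R (h₁ R hR)
        rw [h] at this
        simp only at this
        omega
      · refine ⟨R.dir, by simpa only [← h] using hR, fun δ hδ => ?_⟩
        exact congrArg Rhombus.dir (huniq ⟨t + Pi.single δ 1, δ⟩ ⟨hδ, by simp [Rhombus.cells]⟩)
  · rintro ⟨h₁, h₂, h₃⟩
    refine ⟨fun R hR t ht => ?_, fun t ht => ?_⟩
    · rcases ht with rfl | ht
      · exact (h₁ R hR).2.1
      · rw [Set.mem_singleton_iff] at ht
        exact ht ▸ (h₁ R hR).2.2
    · rcases ht.1 with hs | hs
      · obtain ⟨δ, hδ, huniq⟩ := h₂ t ht hs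
        refine ⟨⟨t, δ⟩, ⟨hδ, by simp [Rhombus.cells]⟩, ?_⟩
        rintro R ⟨hR, htR⟩
        have hR' := (h₁ R hR).1
        rcases (hcells R t).1 htR with h | h
        · rw [h] at hR ⊢
          rw [huniq _ hR]
        · rw [h] at hR'
          simp only [hsum] at hR'
          omega
      · obtain ⟨δ, hδ, huniq⟩ := h₃ t ht hs
        refine ⟨⟨t + Pi.single δ 1, δ⟩, ⟨hδ, by simp [Rhombus.cells]⟩, ?_⟩
        rintro R ⟨hR, htR⟩
        have hR' := (h₁ R hR).1
        rcases (hcells R t).1 htR with h | h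
        · rw [h] at hR'
          simp only at hR'
          omega
        · rw [h] at hR ⊢
          rw [huniq _ hR]

theorem IsRhombusTiling.eq_of_subset {a b : ℤ} {T T' : Set Rhombus} (hT : IsRhombusTiling a b T)
    (hT' : IsRhombusTiling a b T') (h : T ⊆ T') : T = T' := by
  rw [isRhombusTiling_iff] at hT hT'
  refine h.antisymm fun R hR => ?_
  obtain ⟨hs, hi, -⟩ := hT'.1 R hR
  obtain ⟨δ, hδ, -⟩ := hT.2.1 R.tri hi hs
  have := (hT'.2.1 R.tri hi hs).unique (h hδ) (y₂ := R.dir) hR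
  rwa [this] at hδ

/-! ### The tiling with a given height function -/

namespace CyclicHeight

variable {a m : ℕ} (c : CyclicHeight a m)

/-- The condition on the height function `c` under which the upper one of the two unit triangles
in the cell `(x, y)` of the fundamental parallelogram is covered by a rhombus of direction `δ`:
a path leaves the line `x` there, no path passes there, or a path goes down there. -/
def Covers (δ : Fin 3) (x y : ℕ) : Prop :=
  match δ with
  | 0 => c.val (x + 1) y = c.val (x + 1) (y + 1) + 1
  | 1 => c.val x y = c.val (x + 1) (y + 1)
  | 2 => c.val x y = c.val (x + 1) y + 1

/-- The rhombi of the tiling with height function `c` whose triangle `tri` lies in the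
fundamental parallelogram. -/
def fundamentalPart : Set Rhombus :=
  {R | ∃ x y : ℕ, x < a ∧ y < a + m ∧ c.Covers R.dir x y ∧
    R.tri = ![(a : ℤ) - x - 1, (a : ℤ) + m + x - y, (a : ℤ) + y]}

/-- The cyclically symmetric tiling with height function `c`. -/
def tiling : Set Rhombus :=
  {R | R ∈ c.fundamentalPart ∨ R.rotate ∈ c.fundamentalPart ∨ R.rotate.rotate ∈ c.fundamentalPart}

theorem rotate_mem_tiling (R : Rhombus) : R.rotate ∈ c.tiling ↔ R ∈ c.tiling := by
  simp only [tiling, Set.mem_ofPred_eq, R.rotate_rotate_rotate]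
  tauto

theorem existsUnique_covers (x y : ℕ) : ∃! δ, c.Covers δ x y := by
  rw [existsUnique_fin3]
  simp only [Covers]
  have := c.right_le x y
  have := c.up_le (x + 1) y
  have := c.le_diag x y
  omega

theorem mk_mem_fundamentalPart {p q r : ℤ} {δ : Fin 3} :
    (⟨![p, q, r], δ⟩ : Rhombus) ∈ c.fundamentalPart ↔ ∃ x y : ℕ, x < a ∧ y < a + m ∧
      c.Covers δ x y ∧ p = (a : ℤ) - x - 1 ∧ q = (a : ℤ) + m + x - y ∧ r = (a : ℤ) + y := by
  simp only [fundamentalPart, Set.mem_ofPred_eq, vec3_eq_iff]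

theorem cell_mem_tiling (δ : Fin 3) (x y : ℕ) :
    (⟨![(a : ℤ) - x - 1, (a : ℤ) + m + x - y, (a : ℤ) + y], δ⟩ : Rhombus) ∈ c.tiling ↔
      x < a ∧ y < a + m ∧ c.Covers δ x y := by
  simp only [tiling, Set.mem_ofPred_eq, Rhombus.rotate_mk, mk_mem_fundamentalPart]
  constructor
  · rintro (⟨x', y', hx, hy, h, h₁, h₂, h₃⟩ | ⟨x', y', hx, hy, h, h₁, h₂, h₃⟩ |
      ⟨x', y', hx, hy, h, h₁, h₂, h₃⟩)
    · obtain rfl : x = x' := by omega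
      obtain rfl : y = y' := by omega
      exact ⟨hx, hy, h⟩
    · omega
    · omega
  · rintro ⟨hx, hy, h⟩
    exact Or.inl ⟨x, y, hx, hy, h, rfl, rfl, rfl⟩

theorem horizontal_mem_tiling (x y : ℕ) :
    horizontalRhombus a ((a : ℤ) + m) x y ∈ c.tiling ↔
      c.val (x + 1) y = c.val (x + 1) (y + 1) + 1 := by
  rw [horizontalRhombus, cell_mem_tiling]
  refine ⟨fun h => h.2.2, fun h => ⟨?_, ?_, h⟩⟩
  · by_contra hx
    rw [c.eq_zero_of_le_left y (by omega)] at h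
    omega
  · by_contra hy
    rw [c.eq_zero_of_le_right (x + 1) (show a + m ≤ y by omega)] at h
    omega

theorem vertical_mem_tiling (x y : ℕ) :
    verticalRhombus a ((a : ℤ) + m) x y ∈ c.tiling ↔ c.val x y = c.val (x + 1) y + 1 := by
  rw [verticalRhombus, cell_mem_tiling]
  refine ⟨fun h => h.2.2, fun h => ⟨?_, ?_, h⟩⟩
  · by_contra hx
    rw [c.eq_zero_of_le_left y (show a ≤ x by omega)] at h
    omega
  · by_contra hy
    rw [c.eq_zero_of_le_right x (show a + m ≤ y by omega)] at h
    omega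

theorem start_mem_tiling (y : ℕ) :
    horizontalRhombus a ((a : ℤ) + m) (-1) y ∈ c.tiling ↔ c.val 0 y = c.val 0 (y + 1) + 1 := by
  simp only [horizontalRhombus, tiling, Set.mem_ofPred_eq, Rhombus.rotate_mk,
    mk_mem_fundamentalPart]
  constructor
  · rintro (⟨x', y', hx, hy, h, h₁, h₂, h₃⟩ | ⟨x', y', hx, hy, h, h₁, h₂, h₃⟩ |
      ⟨x', y', hx, hy, h, h₁, h₂, h₃⟩)
    · omega
    · omega
    · obtain rfl : y' = 0 := by omega
      obtain rfl : y = x' + m := by omega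
      have h' : c.val x' 0 = c.val (x' + 1) 0 + 1 := h
      rw [show x' + m + 1 = x' + 1 + m by omega, c.glue, c.glue, h']
  · intro h
    have hy : m ≤ y := by
      by_contra hy
      rw [c.eq_of_le_m (show y ≤ m by omega), c.eq_of_le_m (show y + 1 ≤ m by omega)] at h
      omega
    have hy' : y < a + m := by
      by_contra hy
      rw [c.eq_zero_of_le_right 0 (show a + m ≤ y by omega)] at h
      omega
    obtain ⟨x, rfl⟩ := Nat.exists_eq_add_of_le' hy
    rw [show x + m + 1 = x + 1 + m by omega, c.glue, c.glue] at h
    exact Or.inr (Or.inr ⟨x, 0, by omega, by omega, h, by push_cast; ring, by push_cast; ring,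
      by push_cast; ring⟩)

theorem tiling_injective : Function.Injective (tiling : CyclicHeight a m → Set Rhombus) := by
  intro c e h
  have key : ∀ x y, c.val x y = c.val x (y + 1) + 1 ↔ e.val x y = e.val x (y + 1) + 1 := by
    intro x y
    cases x with
    | zero => rw [← start_mem_tiling, ← start_mem_tiling, h]
    | succ x => rw [← horizontal_mem_tiling, ← horizontal_mem_tiling, h]
  refine ext_val fun x => ?_
  have : ∀ k y, a + m ≤ y + k → c.val x y = e.val x y := by
    intro k
    induction k with
    | zero => exact fun y hy => (c.eq_zero_of_le_right x hy).trans (e.eq_zero_of_le_right x hy).symm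
    | succ k ih =>
      intro y hy
      have := ih (y + 1) (by omega)
      have := key x y
      have := c.le_diag x y
      have := e.le_diag x y
      have := c.right_le x (y + 1)
      have := e.right_le x (y + 1)
      have := c.up_le x y
      have := e.up_le x y
      omega
  exact fun y => this (a + m) y (by omega)

/-- A statement about all triangles of the holey hexagon that is invariant under rotation has to be
checked in the fundamental parallelogram only. -/
theorem forall_of_fundamental {P : (Fin 3 → ℤ) → Prop}
    (hrot : ∀ p q r, P ![r, p, q] → P ![p, q, r])
    (h : ∀ p q r, InHoleyHexagon a ((a : ℤ) + m) ![p, q, r] → p < a → a ≤ r → P ![p, q, r]) :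
    ∀ t, InHoleyHexagon a ((a : ℤ) + m) t → P t := by
  intro t ht
  obtain ⟨p, q, r, δ, heq⟩ := Rhombus.exists_eq_mk ⟨t, 0⟩
  obtain rfl : t = ![p, q, r] := congrArg Rhombus.tri heq
  have ht' := inHoleyHexagon_mk.1 ht
  by_cases h₁ : p < a ∧ a ≤ r
  · exact h p q r ht h₁.1 h₁.2
  by_cases h₂ : r < a ∧ a ≤ q
  · exact hrot p q r (h r p q (inHoleyHexagon_mk.2 (by omega)) h₂.1 h₂.2)
  · exact hrot p q r (hrot r p q (h q r p (inHoleyHexagon_mk.2 (by omega)) (by omega) (by omega)))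

theorem existsUnique_fin3_add_one {P Q : Fin 3 → Prop} (h : ∀ δ, P (δ + 1) ↔ Q δ)
    (hP : ∃! δ, P δ) : ∃! δ, Q δ := by
  rw [existsUnique_fin3] at hP ⊢
  rw [← h, ← h, ← h]
  simp only [Fin.isValue, zero_add, show (1 : Fin 3) + 1 = 2 from rfl,
    show (2 : Fin 3) + 1 = 0 from rfl]
  tauto

theorem vec3_add_single (p q r : ℤ) :
    (![p, q, r] + Pi.single 0 1 : Fin 3 → ℤ) = ![p + 1, q, r] ∧
    (![p, q, r] + Pi.single 1 1 : Fin 3 → ℤ) = ![p, q + 1, r] ∧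
    (![p, q, r] + Pi.single 2 1 : Fin 3 → ℤ) = ![p, q, r + 1] := by
  refine ⟨?_, ?_, ?_⟩ <;> funext i <;> fin_cases i <;> simp

theorem vec3_sub_single (p q r : ℤ) :
    (![p, q, r] - Pi.single 0 1 : Fin 3 → ℤ) = ![p - 1, q, r] ∧
    (![p, q, r] - Pi.single 1 1 : Fin 3 → ℤ) = ![p, q - 1, r] ∧
    (![p, q, r] - Pi.single 2 1 : Fin 3 → ℤ) = ![p, q, r - 1] := by
  refine ⟨?_, ?_, ?_⟩ <;> funext i <;> fin_cases i <;> simp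

theorem rotate_add_single (p q r : ℤ) (δ : Fin 3) :
    Rhombus.rotate ⟨![p, q, r] + Pi.single δ 1, δ⟩ = ⟨![r, p, q] + Pi.single (δ + 1) 1, δ + 1⟩ := by
  obtain rfl | rfl | rfl : δ = 0 ∨ δ = 1 ∨ δ = 2 := by omega
  · simp only [vec3_add_single, Rhombus.rotate_mk, zero_add]
  · simp only [vec3_add_single, Rhombus.rotate_mk, show (1 : Fin 3) + 1 = 2 from rfl]
  · simp only [vec3_add_single, Rhombus.rotate_mk, show (2 : Fin 3) + 1 = 0 from rfl]

/-- The conditions on a single rhombus of a tiling, in a form that is invariant under rotation. -/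
theorem inside_of_rotate {a b : ℤ} {R : Rhombus}
    (h : ∑ i, R.rotate.tri i = 2 * a + b - 1 ∧ InHoleyHexagon a b R.rotate.tri ∧
      InHoleyHexagon a b (R.rotate.tri - Pi.single R.rotate.dir 1)) :
    ∑ i, R.tri i = 2 * a + b - 1 ∧ InHoleyHexagon a b R.tri ∧
      InHoleyHexagon a b (R.tri - Pi.single R.dir 1) := by
  obtain ⟨p, q, r, δ, rfl⟩ := R.exists_eq_mk
  rw [Rhombus.rotate_mk] at h
  obtain rfl | rfl | rfl : δ = 0 ∨ δ = 1 ∨ δ = 2 := by omega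
  · simp only [vec3_sub_single, sum_vec3, inHoleyHexagon_mk, zero_add] at h ⊢
    omega
  · simp only [vec3_sub_single, sum_vec3, inHoleyHexagon_mk,
      show (1 : Fin 3) + 1 = 2 from rfl] at h ⊢
    omega
  · simp only [vec3_sub_single, sum_vec3, inHoleyHexagon_mk,
      show (2 : Fin 3) + 1 = 0 from rfl] at h ⊢
    omega

theorem isRhombusTiling_tiling : IsRhombusTiling a ((a : ℤ) + m) c.tiling := by
  rw [isRhombusTiling_iff]
  refine ⟨fun R hR => ?_, ?_, ?_⟩
  · have key : ∀ R ∈ c.fundamentalPart, ∑ i, R.tri i = 2 * (a : ℤ) + ((a : ℤ) + m) - 1 ∧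
        InHoleyHexagon a ((a : ℤ) + m) R.tri ∧
        InHoleyHexagon a ((a : ℤ) + m) (R.tri - Pi.single R.dir 1) := by
      intro R hR
      obtain ⟨p, q, r, δ, rfl⟩ := R.exists_eq_mk
      obtain ⟨x, y, hx, hy, h, rfl, rfl, rfl⟩ := c.mk_mem_fundamentalPart.1 hR
      have hx' : δ = 0 → x + 1 < a := by
        rintro rfl
        by_contra hx'
        simp only [Covers] at h
        rw [c.eq_zero_of_le_left y (by omega)] at h
        omega
      obtain rfl | rfl | rfl : δ = 0 ∨ δ = 1 ∨ δ = 2 := by omega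
      · have := hx' rfl
        simp only [vec3_sub_single, sum_vec3, inHoleyHexagon_mk]
        omega
      · simp only [vec3_sub_single, sum_vec3, inHoleyHexagon_mk]
        omega
      · simp only [vec3_sub_single, sum_vec3, inHoleyHexagon_mk]
        omega
    rcases hR with hR | hR | hR
    · exact key R hR
    · exact inside_of_rotate (key _ hR)
    · exact inside_of_rotate (inside_of_rotate (key _ hR))
  · refine forall_of_fundamental ?_ ?_
    · intro p q r h hs
      refine existsUnique_fin3_add_one (fun δ => ?_) (h ?_)
      · rw [← c.rotate_mem_tiling ⟨![p, q, r], δ⟩, Rhombus.rotate_mk]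
      · rw [sum_vec3] at hs ⊢
        omega
    · intro p q r ht hp hr hs
      rw [inHoleyHexagon_mk] at ht
      rw [sum_vec3] at hs
      obtain ⟨x, hx⟩ := Int.eq_ofNat_of_zero_le (show 0 ≤ (a : ℤ) - p - 1 by omega)
      obtain ⟨y, hy⟩ := Int.eq_ofNat_of_zero_le (show 0 ≤ r - (a : ℤ) by omega)
      obtain rfl : p = (a : ℤ) - x - 1 := by omega
      obtain rfl : r = (a : ℤ) + y := by omega
      obtain rfl : q = (a : ℤ) + m + x - y := by omega
      simpa only [cell_mem_tiling, show x < a by omega, show y < a + m by omega, true_and]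
        using c.existsUnique_covers x y
  · refine forall_of_fundamental ?_ ?_
    · intro p q r h hs
      refine existsUnique_fin3_add_one (fun δ => ?_) (h ?_)
      · rw [← c.rotate_mem_tiling ⟨![p, q, r] + _, δ⟩, rotate_add_single]
      · rw [sum_vec3] at hs ⊢
        omega
    · intro p q r ht hp hr hs
      rw [inHoleyHexagon_mk] at ht
      rw [sum_vec3] at hs
      obtain ⟨x, hx⟩ := Int.eq_ofNat_of_zero_le (show 0 ≤ (a : ℤ) - p - 1 by omega)
      obtain ⟨y, hy⟩ := Int.eq_ofNat_of_zero_le (show 0 ≤ r - (a : ℤ) by omega)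
      obtain rfl : p = (a : ℤ) - x - 1 := by omega
      obtain rfl : r = (a : ℤ) + y := by omega
      obtain rfl : q = (a : ℤ) + m + x - y - 1 := by omega
      have h₀ : (⟨![(a : ℤ) - x - 1 + 1, (a : ℤ) + m + x - y - 1, (a : ℤ) + y], 0⟩ : Rhombus) ∈
          c.tiling ↔ c.val x y = c.val x (y + 1) + 1 := by
        cases x with
        | zero =>
          rw [← start_mem_tiling, horizontalRhombus]
          rw [Rhombus.mk_congr] <;> push_cast <;> ring
        | succ x =>
          rw [← horizontal_mem_tiling, horizontalRhombus]
          rw [Rhombus.mk_congr] <;> push_cast <;> ring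
      have h₁ : (⟨![(a : ℤ) - x - 1, (a : ℤ) + m + x - y - 1 + 1, (a : ℤ) + y], 1⟩ : Rhombus) ∈
          c.tiling ↔ c.val x y = c.val (x + 1) (y + 1) := by
        rw [sub_add_cancel, cell_mem_tiling]
        exact ⟨fun h => h.2.2, fun h => ⟨by omega, by omega, h⟩⟩
      have h₂ : (⟨![(a : ℤ) - x - 1, (a : ℤ) + m + x - y - 1, (a : ℤ) + y + 1], 2⟩ : Rhombus) ∈
          c.tiling ↔ c.val x (y + 1) = c.val (x + 1) (y + 1) + 1 := by
        rw [← vertical_mem_tiling, verticalRhombus]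
        rw [Rhombus.mk_congr] <;> push_cast <;> ring
      simp only [existsUnique_fin3, vec3_add_single, h₀, h₁, h₂]
      have := c.up_le x y
      have := c.right_le x (y + 1)
      have := c.le_diag x y
      omega

end CyclicHeight

/-! ### The height function of a given tiling -/

namespace CyclicHeight

variable {a m : ℕ}

/-- The height function of a cyclically symmetric tiling `T` counts the horizontal rhombi that
meet the vertical line `x` at height at least `y`.  The two triangles in each cell of the
fundamental parallelogram give a conservation law for paths; summed along a vertical line it becomes
the recursion `val x y = val (x + 1) y + [vertical rhombus at (x, y)]`, from which everything
follows. -/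
theorem exists_tiling_eq {T : Set Rhombus} (hT : IsRhombusTiling a ((a : ℤ) + m) T)
    (hrot : Rhombus.rotate '' T = T) : ∃ c : CyclicHeight a m, c.tiling = T := by
  classical
  have hT' := isRhombusTiling_iff.1 hT
  rw [Rhombus.rotate_image_eq_iff] at hrot
  obtain ⟨hin, hup, hdown⟩ := hT'
  obtain ⟨z, hz, hz01⟩ : ∃ z : ℕ → ℕ → ℕ, (∀ x y : ℕ, z x y = 1 ↔
      horizontalRhombus a ((a : ℤ) + m) ((x : ℤ) - 1) y ∈ T) ∧ ∀ x y, z x y ≤ 1 :=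
    ⟨fun x y => if horizontalRhombus a ((a : ℤ) + m) ((x : ℤ) - 1) y ∈ T then 1 else 0,
      fun x y => by simp, fun x y => by dsimp only; split_ifs <;> omega⟩
  obtain ⟨w, hw, hw01⟩ : ∃ w : ℕ → ℕ → ℕ, (∀ x y : ℕ, w x y = 1 ↔
      verticalRhombus a ((a : ℤ) + m) x y ∈ T) ∧ ∀ x y, w x y ≤ 1 :=
    ⟨fun x y => if verticalRhombus a ((a : ℤ) + m) x y ∈ T then 1 else 0,
      fun x y => by simp, fun x y => by dsimp only; split_ifs <;> omega⟩
  obtain ⟨o, ho, ho01⟩ : ∃ o : ℕ → ℕ → ℕ, (∀ x y : ℕ, o x y = 1 ↔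
      (⟨![(a : ℤ) - x - 1, (a : ℤ) + m + x - y, (a : ℤ) + y], 1⟩ : Rhombus) ∈ T) ∧
        ∀ x y, o x y ≤ 1 :=
    ⟨fun x y => if (⟨![(a : ℤ) - x - 1, (a : ℤ) + m + x - y, (a : ℤ) + y], 1⟩ : Rhombus) ∈ T
      then 1 else 0, fun x y => by simp, fun x y => by dsimp only; split_ifs <;> omega⟩
  have hz' : ∀ x y : ℕ, z (x + 1) y = 1 ↔
      (⟨![(a : ℤ) - x - 1, (a : ℤ) + m + x - y, (a : ℤ) + y], 0⟩ : Rhombus) ∈ T := by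
    intro x y
    rw [hz, horizontalRhombus]
    rw [Rhombus.mk_congr] <;> push_cast <;> ring
  have hupper : ∀ x y, x < a → y < a + m → z (x + 1) y + o x y + w x y = 1 := by
    intro x y hx hy
    have h := hup ![(a : ℤ) - x - 1, (a : ℤ) + m + x - y, (a : ℤ) + y]
      (inHoleyHexagon_mk.2 (by omega)) (by rw [sum_vec3]; omega)
    rw [existsUnique_fin3, ← hz', ← ho] at h
    have h₂ := hw x y
    rw [verticalRhombus] at h₂
    rw [← h₂] at h
    have := hz01 (x + 1) y
    have := hw01 x y
    have := ho01 x y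
    omega
  have hlower : ∀ x y, x < a → y < a + m → z x y + o x y + w x (y + 1) = 1 := by
    intro x y hx hy
    have h := hdown ![(a : ℤ) - x - 1, (a : ℤ) + m + x - y - 1, (a : ℤ) + y]
      (inHoleyHexagon_mk.2 (by omega)) (by rw [sum_vec3]; omega)
    simp only [existsUnique_fin3, vec3_add_single, sub_add_cancel, ← ho] at h
    have h₁ := hz x y
    rw [horizontalRhombus, Rhombus.mk_congr (show (a : ℤ) - (x - 1) - 1 = (a : ℤ) - x by ring)
      (show (a : ℤ) + m + (x - 1) - y = (a : ℤ) + m + x - y - 1 by ring) rfl] at h₁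
    have h₂ := hw x (y + 1)
    rw [verticalRhombus, Rhombus.mk_congr rfl
      (show (a : ℤ) + m + x - (y + 1 : ℕ) = (a : ℤ) + m + x - y - 1 by push_cast; ring)
      (show (a : ℤ) + (y + 1 : ℕ) = (a : ℤ) + y + 1 by push_cast; ring)] at h₂
    rw [← h₁, ← h₂] at h
    have := hz01 x y
    have := hw01 x (y + 1)
    have := ho01 x y
    omega
  have hwtop : ∀ x, w x (a + m) = 0 := by
    intro x
    by_contra h
    have := (hw x (a + m)).1 (by have := hw01 x (a + m); omega)
    have := (inHoleyHexagon_mk.1 (hin _ this).2.1).2.2.2.1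
    push_cast at this
    omega
  have hzright : ∀ x y, a ≤ x → z x y = 0 := by
    intro x y hx
    by_contra h
    have := (hz x y).1 (by have := hz01 x y; omega)
    have := (hin _ this).2.2
    simp only [horizontalRhombus, vec3_sub_single, inHoleyHexagon_mk] at this
    omega
  have hwz : ∀ x, w x 0 = z 0 (x + m) := by
    intro x
    have h : w x 0 = 1 ↔ z 0 (x + m) = 1 := by
      rw [hw, hz, ← hrot, verticalRhombus, horizontalRhombus, Rhombus.rotate_mk]
      rw [show (2 : Fin 3) + 1 = 0 from rfl, Rhombus.mk_congr] <;> push_cast <;> ring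
    have := hw01 x 0
    have := hz01 0 (x + m)
    omega
  -- the height function
  obtain ⟨c, hcstep, hctop⟩ : ∃ c : ℕ → ℕ → ℕ,
      (∀ x y, y < a + m → c x y = z x y + c x (y + 1)) ∧ ∀ x y, a + m ≤ y → c x y = 0 := by
    refine ⟨fun x y => ∑ y' ∈ Finset.Ico y (a + m), z x y', fun x y hy => ?_, fun x y hy => ?_⟩
    · exact Finset.sum_eq_sum_Ico_succ_bot hy _
    · simp [hy]
  -- downward induction along a vertical line
  have hind : ∀ P : ℕ → Prop, (∀ y, a + m ≤ y → P y) → (∀ y, y < a + m → P (y + 1) → P y) →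
      ∀ y, P y := by
    intro P h₀ h₁ y
    by_cases hy : a + m ≤ y
    · exact h₀ y hy
    · exact Nat.decreasingInduction (motive := fun k _ => P k) (fun k hk => h₁ k hk)
        (h₀ _ le_rfl) (not_le.mp hy).le
  have hcright : ∀ x y, a ≤ x → c x y = 0 := by
    intro x y hx
    refine hind (fun y => c x y = 0) (hctop x) (fun y hy h => ?_) y
    rw [hcstep x y hy, hzright x y hx, h]
  have hflow : ∀ x y, x < a → y ≤ a + m → c x y = c (x + 1) y + w x y := by
    intro x y hx
    refine hind (fun y => y ≤ a + m → c x y = c (x + 1) y + w x y) (fun y hy hy' => ?_)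
      (fun y hy h _ => ?_) y
    · obtain rfl : y = a + m := by omega
      rw [hctop x _ hy, hctop (x + 1) _ hy, hwtop]
    · have := h (by omega)
      rw [hcstep x y hy, hcstep (x + 1) y hy]
      have := hupper x y hx hy
      have := hlower x y hx hy
      omega
  have hglue : ∀ x, c 0 (x + m) = c x 0 := by
    intro x
    refine hind (fun y => ∀ x, x + m = y → c 0 (x + m) = c x 0) (fun y hy x hxy => ?_)
      (fun y hy h x hxy => ?_) (x + m) x rfl
    · rw [hctop _ _ (by omega), hcright _ _ (by omega)]
    · have := h (x + 1) (by omega)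
      rw [hcstep 0 (x + m) (by omega), hflow x 0 (by omega) (by omega), hwz]
      rw [show x + 1 + m = x + m + 1 by omega] at this
      omega
  let C : CyclicHeight a m :=
    { val := c
      right_le := fun x y => by
        by_cases hx : x < a
        · by_cases hy : y ≤ a + m
          · rw [hflow x y hx hy]; omega
          · rw [hctop (x + 1) y (by omega)]; omega
        · rw [hcright (x + 1) y (by omega)]; omega
      up_le := fun x y => by
        by_cases hy : y < a + m
        · rw [hcstep x y hy]; omega
        · rw [hctop x (y + 1) (by omega)]; omega
      le_diag := fun x y => by
        by_cases hx : x < a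
        · by_cases hy : y < a + m
          · rw [hflow x y hx hy.le, hcstep (x + 1) y hy]
            have := hupper x y hx hy
            omega
          · rw [hctop x y (by omega)]; omega
        · rw [hcright x y (by omega)]; omega
      glue := hglue
      vanish := hcright a 0 le_rfl }
  refine ⟨C, C.isRhombusTiling_tiling.eq_of_subset hT fun R hR => ?_⟩
  have key : ∀ R ∈ C.fundamentalPart, R ∈ T := by
    intro R hR
    obtain ⟨p, q, r, δ, rfl⟩ := R.exists_eq_mk
    obtain ⟨x, y, hx, hy, h, rfl, rfl, rfl⟩ := C.mk_mem_fundamentalPart.1 hR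
    have h₁ := hflow x y hx hy.le
    have h₂ := hcstep (x + 1) y hy
    have h₃ := hupper x y hx hy
    obtain rfl | rfl | rfl : δ = 0 ∨ δ = 1 ∨ δ = 2 := by omega
    · change c (x + 1) y = c (x + 1) (y + 1) + 1 at h
      exact (hz' x y).1 (by omega)
    · change c x y = c (x + 1) (y + 1) at h
      exact (ho x y).1 (by omega)
    · change c x y = c (x + 1) y + 1 at h
      exact (hw x y).1 (by omega)
  rcases hR with hR | hR | hR
  · exact key R hR
  · exact (hrot R).1 (key _ hR)
  · exact (hrot R).1 ((hrot _).1 (key _ hR))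

/-- Cyclic height functions correspond to cyclically symmetric tilings. -/
noncomputable def tilingEquiv : CyclicHeight a m ≃ CSRhombusTiling a ((a : ℤ) + m) :=
  Equiv.ofBijective
    (fun c => ⟨c.tiling, c.isRhombusTiling_tiling,
      Rhombus.rotate_image_eq_iff.2 c.rotate_mem_tiling⟩)
    ⟨fun _ _ h => tiling_injective (congrArg Subtype.val h), fun T => by
      obtain ⟨c, hc⟩ := exists_tiling_eq T.2.1 T.2.2
      exact ⟨c, Subtype.ext hc⟩⟩

/-! ### The lattice paths of a tiling -/

variable (c : CyclicHeight a m)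

/-- The list `w` consists of the heights at which path number `i` enters the vertical lines
`x, x + 1, …`. -/
def WordSpec (i x : ℕ) (w : List ℕ) : Prop :=
  ∀ j v, w[j]? = some v ↔ c.val (x + j) (v + 1) ≤ i ∧ i < c.val (x + j) v

variable {c}

theorem WordSpec.cons {i x y : ℕ} {w : List ℕ} (hw : c.WordSpec i (x + 1) w)
    (h₁ : c.val x (y + 1) ≤ i) (h₂ : i < c.val x y) : c.WordSpec i x (y :: w) := by
  intro j v
  cases j with
  | zero =>
    simp only [List.getElem?_cons_zero, Option.some.injEq, add_zero]
    constructor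
    · rintro rfl
      exact ⟨h₁, h₂⟩
    · rintro ⟨h₃, h₄⟩
      exact c.top_unique h₁ h₂ h₃ h₄
  | succ j =>
    rw [List.getElem?_cons_succ, hw j v, show x + 1 + j = x + (j + 1) by omega]

/-- A path from `(x, y)` in the tiling with height function `c` has the number `c.val x y - 1`. -/
theorem wordSpec_of_isPathFrom {x y : ℕ} {w : List ℕ}
    (h : IsPathFrom a ((a : ℤ) + m) c.tiling x y w) :
    c.val x y = c.val (x + 1) (y + 1) + 1 ∧ c.WordSpec (c.val (x + 1) (y + 1)) (x + 1) w := by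
  induction h with
  | finish x h =>
    have h := (c.vertical_mem_tiling x 0).1 (by exact_mod_cast h)
    have h₁ := c.le_diag x 0
    have h₂ := c.up_le (x + 1) 0
    have h₃ : c.val (x + 1) (0 + 1) = c.val (x + 1) 0 := by omega
    refine ⟨by omega, fun j v => ?_⟩
    have := c.val_anti (show x + 1 ≤ x + 1 + j by omega) (Nat.zero_le v)
    rw [h₃]
    simp
    omega
  | right x y w h _ ih =>
    rw [horizontal_mem_tiling] at h
    have h₁ := c.le_diag x y
    have h₂ := c.right_le x y
    obtain ⟨h₃, h₄⟩ := ih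
    have h₅ : c.val (x + 1 + 1) (y + 1) = c.val (x + 1) (y + 1) := by omega
    rw [h₅] at h₄
    exact ⟨by omega, h₄.cons le_rfl (by omega)⟩
  | down x y w h _ ih =>
    have h := (c.vertical_mem_tiling x (y + 1)).1 (by exact_mod_cast h)
    have h₁ := c.le_diag x (y + 1)
    have h₂ := c.up_le (x + 1) (y + 1)
    have h₃ : c.val (x + 1) (y + 1 + 1) = c.val (x + 1) (y + 1) := by omega
    rw [h₃]
    exact ⟨h, ih.2⟩

theorem exists_isPathFrom (k : ℕ) : ∀ x y : ℕ, a + y ≤ x + k →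
    c.val x y = c.val (x + 1) (y + 1) + 1 → ∃ w, IsPathFrom a ((a : ℤ) + m) c.tiling x y w := by
  induction k with
  | zero =>
    intro x y hk h
    rw [c.eq_zero_of_le_left y (show a ≤ x by omega)] at h
    omega
  | succ k ih =>
    intro x y hk h
    have h₁ := c.right_le x y
    have h₂ := c.up_le (x + 1) y
    by_cases hx : c.val (x + 1) y = c.val x y
    · have h₃ := c.le_diag (x + 1) y
      have h₄ := c.right_le (x + 1) (y + 1)
      obtain ⟨w, hw⟩ := ih (x + 1) y (by omega) (by omega)
      exact ⟨y :: w, .right x y w ((c.horizontal_mem_tiling x y).2 (by omega)) hw⟩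
    · have hv := (c.vertical_mem_tiling x y).2 (by omega)
      cases y with
      | zero => exact ⟨[], .finish x (by exact_mod_cast hv)⟩
      | succ y =>
        have h₃ := c.le_diag x y
        have h₄ := c.up_le x y
        obtain ⟨w, hw⟩ := ih x y (by omega) (by omega)
        exact ⟨w, .down x y w (by exact_mod_cast hv) hw⟩

theorem wordSpec_of_isPathWord {w : List ℕ} (h : IsPathWord a ((a : ℤ) + m) c.tiling w) :
    ∃ i, i < c.val 0 0 ∧ c.WordSpec i 0 w := by
  obtain ⟨y, u, hy, hu, rfl⟩ := h
  rw [start_mem_tiling] at hy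
  obtain ⟨h₁, h₂⟩ := wordSpec_of_isPathFrom hu
  have := c.antitone_right 0 (Nat.zero_le y)
  exact ⟨c.val (0 + 1) (y + 1), by omega, h₂.cons (by omega) (by omega)⟩

theorem exists_isPathWord {i : ℕ} (hi : i < c.val 0 0) :
    ∃ w, IsPathWord a ((a : ℤ) + m) c.tiling w ∧ c.WordSpec i 0 w := by
  obtain ⟨y, -, h₁, h₂⟩ := c.exists_top hi
  have h₃ := c.le_diag 0 y
  have h₄ := c.right_le 0 (y + 1)
  obtain ⟨u, hu⟩ := exists_isPathFrom (c := c) (a + y) 0 y (by omega) (by omega)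
  refine ⟨y :: u, ⟨y, u, (c.start_mem_tiling y).2 (by omega), hu, rfl⟩, ?_⟩
  have h₅ := (wordSpec_of_isPathFrom hu).2
  rw [show c.val (0 + 1) (y + 1) = i by omega] at h₅
  exact h₅.cons h₁ h₂

theorem getElem?_filter_pos {w : List ℕ} (hw : w.Pairwise (· ≥ ·)) (j v : ℕ) :
    (w.filter fun v => 0 < v)[j]? = some v ↔ w[j]? = some v ∧ 0 < v := by
  induction w generalizing j with
  | nil => simp
  | cons u w ih =>
    obtain ⟨hu, hw⟩ := List.pairwise_cons.1 hw
    by_cases h0 : 0 < u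
    · rw [List.filter_cons_of_pos (by simpa using h0)]
      cases j with
      | zero => simp; omega
      | succ j => simpa using ih hw j
    · have hall : ∀ x ∈ u :: w, x = 0 := by
        intro x hx
        rcases List.mem_cons.1 hx with rfl | hx
        · omega
        · have := hu x hx
          omega
      rw [List.filter_eq_nil_iff.2 fun x hx => by simp [hall x hx]]
      constructor
      · simp
      · rintro ⟨h, hv⟩
        have := hall v (List.mem_of_getElem? h)
        omega

theorem WordSpec.rowSpec {i : ℕ} {w : List ℕ} (hw : c.WordSpec i 0 w) :
    c.RowSpec i (if m = 0 then w else w.filter fun v => 0 < v) := by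
  have hw' : ∀ j v, w[j]? = some v ↔ c.val j (v + 1) ≤ i ∧ i < c.val j v := by
    intro j v
    rw [hw, zero_add]
  intro j v
  split_ifs with h
  · rw [hw']
    tauto
  · rw [getElem?_filter_pos, hw']
    · tauto
    · rw [List.pairwise_iff_getElem]
      intro p q hp hq hpq
      obtain ⟨h₁, h₂⟩ := (hw' p _).1 (List.getElem?_eq_getElem hp)
      obtain ⟨h₃, h₄⟩ := (hw' q _).1 (List.getElem?_eq_getElem hq)
      by_contra hlt
      have := c.val_anti hpq.le (show w[p] + 1 ≤ w[q] by omega)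
      omega

theorem readOff_tiling {d : ℤ} {n : ℕ} (hm : 2 - d = m) {π : DescendingPP d n}
    (h : π.Matches c) : ReadOff a ((a : ℤ) + m) c.tiling π := by
  intro r
  have hd : (d = 2) = (m = 0) := propext (by omega)
  rw [h.mem_rows_iff]
  simp only [hd]
  constructor
  · rintro ⟨i, hi, hr⟩
    obtain ⟨w, hw, hs⟩ := exists_isPathWord hi
    exact ⟨w, hw, hr.unique hs.rowSpec⟩
  · rintro ⟨w, hw, rfl⟩
    obtain ⟨i, hi, hs⟩ := wordSpec_of_isPathWord hw
    exact ⟨i, hi, hs.rowSpec⟩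

/-! ### The reflected tiling -/

theorem reflect_mem_tiling_of_rotate {R : Rhombus} (h : R.rotate.reflect ∈ c.tiling) :
    R.reflect ∈ c.tiling := by
  rw [← R.rotate_reflect_rotate, c.rotate_mem_tiling]
  exact h

theorem reflect_mem_tiling {R : Rhombus} (hR : R ∈ c.reflect.tiling) : R.reflect ∈ c.tiling := by
  have key : ∀ R ∈ c.reflect.fundamentalPart, R.reflect ∈ c.tiling := by
    intro R hR
    obtain ⟨p, q, r, δ, rfl⟩ := R.exists_eq_mk
    obtain ⟨x, y, hx, hy, h, rfl, rfl, rfl⟩ := c.reflect.mk_mem_fundamentalPart.1 hR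
    rw [Rhombus.reflect_mk]
    have hb₁ := c.le_sub_left x (x + m - y)
    have hb₂ := c.le_sub_left (x + 1) (x + m - y)
    have hb₃ := c.le_sub_left (x + 1) (x + m - y + 1)
    have hb₄ := c.le_sub_right (y - x - m) y
    have hb₅ := c.le_sub_right (y - x - m - 1) y
    have hb₆ := c.le_sub_right (y - x - m) (y + 1)
    by_cases hxy : y ≤ x + m
    · rw [Rhombus.mk_congr rfl
        (show (a : ℤ) + y = (a : ℤ) + m + x - (x + m - y : ℕ) by omega)
        (show (a : ℤ) + m + x - y = (a : ℤ) + (x + m - y : ℕ) by omega), cell_mem_tiling]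
      refine ⟨hx, by omega, ?_⟩
      have e₁ := c.reflect_val_of_le hxy
      have e₂ := c.reflect_val_of_le (show y ≤ x + 1 + m by omega)
      have e₃ := c.reflect_val_of_le (show y + 1 ≤ x + 1 + m by omega)
      rw [show x + 1 + m - y = x + m - y + 1 by omega] at e₂
      rw [show x + 1 + m - (y + 1) = x + m - y by omega] at e₃
      obtain rfl | rfl | rfl : δ = 0 ∨ δ = 1 ∨ δ = 2 := by omega
      · change c.reflect.val (x + 1) y = c.reflect.val (x + 1) (y + 1) + 1 at h
        change c.val (x + 1) (x + m - y) = c.val (x + 1) (x + m - y + 1) + 1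
        omega
      · change c.reflect.val x y = c.reflect.val (x + 1) (y + 1) at h
        change c.val x (x + m - y) = c.val (x + 1) (x + m - y) + 1
        omega
      · change c.reflect.val x y = c.reflect.val (x + 1) y + 1 at h
        change c.val x (x + m - y) = c.val (x + 1) (x + m - y + 1)
        omega
    · obtain ⟨k, rfl⟩ := Nat.exists_eq_add_of_lt (not_le.mp hxy)
      rw [← c.rotate_mem_tiling, Rhombus.rotate_mk, Rhombus.mk_congr
        (show (a : ℤ) + m + x - (x + m + k + 1 : ℕ) = (a : ℤ) - k - 1 by omega)
        (show (a : ℤ) - x - 1 = (a : ℤ) + m + k - (x + m + k + 1 : ℕ) by omega) rfl,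
        cell_mem_tiling]
      refine ⟨by omega, by omega, ?_⟩
      have e₁ := c.reflect_val_of_ge (show x + m ≤ x + m + k + 1 by omega)
      have e₂ := c.reflect_val_of_ge (show x + 1 + m ≤ x + m + k + 1 by omega)
      have e₃ := c.reflect_val_of_ge (show x + 1 + m ≤ x + m + k + 1 + 1 by omega)
      rw [show x + m + k + 1 - x - m = k + 1 by omega] at e₁
      rw [show x + m + k + 1 - (x + 1) - m = k by omega] at e₂
      rw [show x + m + k + 1 + 1 - (x + 1) - m = k + 1 by omega] at e₃
      rw [show x + m + k + 1 - x - m = k + 1 by omega] at hb₄ hb₅ hb₆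
      rw [show k + 1 - 1 = k by omega] at hb₅
      obtain rfl | rfl | rfl : δ = 0 ∨ δ = 1 ∨ δ = 2 := by omega
      · change c.reflect.val (x + 1) _ = c.reflect.val (x + 1) _ + 1 at h
        change c.val k (x + m + k + 1) = c.val (k + 1) (x + m + k + 1 + 1)
        omega
      · change c.reflect.val x _ = c.reflect.val (x + 1) _ at h
        change c.val (k + 1) (x + m + k + 1) = c.val (k + 1) (x + m + k + 1 + 1) + 1
        omega
      · change c.reflect.val x _ = c.reflect.val (x + 1) _ + 1 at h
        change c.val k (x + m + k + 1) = c.val (k + 1) (x + m + k + 1) + 1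
        omega
  rcases hR with hR | hR | hR
  · exact key R hR
  · exact reflect_mem_tiling_of_rotate (key _ hR)
  · exact reflect_mem_tiling_of_rotate (reflect_mem_tiling_of_rotate (key _ hR))

theorem tiling_reflect (c : CyclicHeight a m) :
    c.reflect.tiling = Rhombus.reflect '' c.tiling := by
  ext R
  constructor
  · intro hR
    exact ⟨R.reflect, reflect_mem_tiling hR, R.reflect_reflect⟩
  · rintro ⟨S, hS, rfl⟩
    refine reflect_mem_tiling ?_
    rwa [reflect_reflect]

end CyclicHeight

/-! ### Rigidity of the lattice of cyclic height functions -/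

namespace CyclicHeight

variable {a m : ℕ}

/-- The distance from `(x₀, y₀)` to `(x, y)` in the parallelogram with glued borders, where a step
that increases both coordinates by `1` has length `1` and steps that decrease a coordinate are
free.  The three terms of the minimum are the lengths of a shortest way that does not meet the
border, that leaves through the left border and returns through the bottom border, and vice
versa. -/
def glueDist (m x₀ y₀ x y : ℕ) : ℕ :=
  min (max (x - x₀) (y - y₀)) (min (max y (x - (y₀ - m))) (max x (y - m - x₀)))

theorem glueDist_le_iff {x₀ y₀ x y k : ℕ} : glueDist m x₀ y₀ x y ≤ k ↔
    x ≤ x₀ + k ∧ y ≤ y₀ + k ∨ y ≤ k ∧ (x ≤ k ∨ x + m ≤ y₀ + k) ∨ x ≤ k ∧ y ≤ m + x₀ + k := by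
  simp only [glueDist, min_le_iff, max_le_iff]
  omega

/-- The least cyclic height function whose value at `(x₀, y₀)` is at least `h` (where `h` is
replaced by the largest possible value at `(x₀, y₀)` if it exceeds it). -/
def least (x₀ y₀ h : ℕ) : CyclicHeight a m where
  val x y := min h (min (a - x₀) (a + m - y₀)) - glueDist m x₀ y₀ x y
  right_le x y := by
    have := glueDist_le_iff.1 (le_refl (glueDist m x₀ y₀ (x + 1) y))
    exact Nat.sub_le_sub_left (glueDist_le_iff.2 (by omega)) _
  up_le x y := by
    have := glueDist_le_iff.1 (le_refl (glueDist m x₀ y₀ x (y + 1)))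
    exact Nat.sub_le_sub_left (glueDist_le_iff.2 (by omega)) _
  le_diag x y := by
    have := glueDist_le_iff.1 (le_refl (glueDist m x₀ y₀ x y))
    have h₁ : glueDist m x₀ y₀ (x + 1) (y + 1) ≤ glueDist m x₀ y₀ x y + 1 :=
      glueDist_le_iff.2 (by omega)
    omega
  glue x := by
    refine congrArg _ (eq_of_forall_ge_iff fun k => ?_)
    rw [glueDist_le_iff, glueDist_le_iff]
    omega
  vanish := by
    have := glueDist_le_iff.1 (le_refl (glueDist m x₀ y₀ a 0))
    omega

theorem least_val_le (x₀ y₀ h x y : ℕ) : (least x₀ y₀ h : CyclicHeight a m).val x y ≤ h := by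
  simp only [least]
  omega

theorem least_le {c : CyclicHeight a m} {x₀ y₀ h : ℕ} (hc : h ≤ c.val x₀ y₀) :
    least x₀ y₀ h ≤ c := by
  intro x y
  -- one lower bound for `c.val x y` for each of the three ways from `(x₀, y₀)` to `(x, y)`
  have h₁ := c.le_diag_add x₀ y₀ (max (x - x₀) (y - y₀))
  have h₁' := c.val_anti (show x ≤ x₀ + max (x - x₀) (y - y₀) by omega)
    (show y ≤ y₀ + max (x - x₀) (y - y₀) by omega)
  have h₂ : c.val 0 y₀ = c.val (y₀ - m) 0 := by
    rcases le_total y₀ m with h | h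
    · rw [c.eq_of_le_m h, Nat.sub_eq_zero_of_le h]
    · rw [← c.glue, Nat.sub_add_cancel h]
  have h₃ := c.val_anti (Nat.zero_le x₀) (le_refl y₀)
  have h₄ := c.le_diag_add (y₀ - m) 0 (max y (x - (y₀ - m)))
  have h₄' := c.val_anti (show x ≤ y₀ - m + max y (x - (y₀ - m)) by omega)
    (show y ≤ 0 + max y (x - (y₀ - m)) by omega)
  have h₅ := c.val_anti (le_refl x₀) (Nat.zero_le y₀)
  have h₆ := c.glue x₀
  have h₇ := c.le_diag_add 0 (x₀ + m) (max x (y - m - x₀))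
  have h₇' := c.val_anti (show x ≤ 0 + max x (y - m - x₀) by omega)
    (show y ≤ x₀ + m + max x (y - m - x₀) by omega)
  have h₈ : h - c.val x y ≤ glueDist m x₀ y₀ x y := by
    refine le_min ?_ (le_min ?_ ?_) <;> omega
  simp only [least]
  omega

theorem least_le_iff {c : CyclicHeight a m} {x₀ y₀ h : ℕ} (hx : h + x₀ ≤ a)
    (hy : h + y₀ ≤ a + m) : least x₀ y₀ h ≤ c ↔ h ≤ c.val x₀ y₀ := by
  refine ⟨fun hc => le_trans ?_ (hc x₀ y₀), least_le⟩
  have : glueDist m x₀ y₀ x₀ y₀ ≤ 0 := glueDist_le_iff.2 (by omega)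
  simp only [least]
  omega

/-- The triples that index the sup-irreducible elements of the lattice: possible heights `h` at
the point `(x, y)`, with one point chosen from each pair of points identified by `glue`. -/
structure IsBox (a m x y h : ℕ) : Prop where
  pos : 1 ≤ h
  left : h + x ≤ a
  right : h + y ≤ a + m
  repr : x = 0 → y = 0

/-- The order relation between sup-irreducible elements in terms of their indices. -/
def BoxLE (m x y h x' y' h' : ℕ) : Prop :=
  h ≤ h' ∧ (x + h ≤ x' + h' ∧ y + h ≤ y' + h' ∨
    y + h ≤ h' ∧ (x + h ≤ h' ∨ x + h + m ≤ y' + h') ∨ x + h ≤ h' ∧ y + h ≤ m + x' + h')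

theorem boxLE_same {x y x' y' h : ℕ} : BoxLE m x y h x' y' h ↔
    x ≤ x' ∧ y ≤ y' ∨ y = 0 ∧ (x = 0 ∨ x + m ≤ y') ∨ x = 0 ∧ y ≤ m + x' := by
  unfold BoxLE
  omega

theorem boxLE_origin {h h' x' y' : ℕ} (hh : h ≤ h') : BoxLE m 0 0 h x' y' h' :=
  ⟨hh, Or.inl ⟨by omega, by omega⟩⟩

theorem least_le_least {x y h x' y' h' : ℕ} (hp : IsBox a m x y h) (hq : IsBox a m x' y' h') :
    (least x y h : CyclicHeight a m) ≤ least x' y' h' ↔ BoxLE m x y h x' y' h' := by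
  obtain ⟨h₁, h₂, h₃, -⟩ := hp
  obtain ⟨h₄, h₅, h₆, -⟩ := hq
  rw [least_le_iff h₂ h₃]
  simp only [least]
  rw [min_eq_left (show h' ≤ min (a - x') (a + m - y') by omega), BoxLE]
  have := glueDist_le_iff (m := m) (x₀ := x') (y₀ := y') (x := x) (y := y) (k := h' - h)
  omega

theorem supIrred_least {x y h : ℕ} (hp : IsBox a m x y h) :
    SupIrred (least x y h : CyclicHeight a m) := by
  have hle := fun c : CyclicHeight a m => least_le_iff (c := c) hp.left hp.right
  have hself := (hle (least x y h)).1 le_rfl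
  refine ⟨fun hmin => ?_, fun b c hbc => ?_⟩
  · rw [isMin_iff_eq_bot] at hmin
    rw [hmin, bot_val] at hself
    exact absurd hp.pos (by omega)
  · have h₁ := hself
    rw [← hbc, sup_val, le_max_iff, ← hle, ← hle] at h₁
    exact h₁.imp (le_antisymm (hbc ▸ le_sup_left)) (le_antisymm (hbc ▸ le_sup_right))

theorem exists_eq_least {c : CyclicHeight a m} (hc : SupIrred c) :
    ∃ x y h, IsBox a m x y h ∧ c = least x y h := by
  have hsup : ((Finset.range a ×ˢ Finset.range (a + m)).sup
      fun p => least p.1 p.2 (c.val p.1 p.2)) = c := by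
    refine le_antisymm (Finset.sup_le fun p _ => least_le le_rfl) fun x y => ?_
    by_cases hx : a ≤ x
    · rw [c.eq_zero_of_le_left y hx]; exact Nat.zero_le _
    by_cases hy : a + m ≤ y
    · rw [c.eq_zero_of_le_right x hy]; exact Nat.zero_le _
    have h₁ := c.le_sub_left x y
    have h₂ := c.le_sub_right x y
    rw [← least_le_iff (by omega) (by omega)]
    exact Finset.le_sup (f := fun p : ℕ × ℕ => least p.1 p.2 (c.val p.1 p.2)) (b := (x, y))
      (by simp; omega)
  obtain ⟨⟨x, y⟩, hmem, hxy⟩ := hc.finset_sup_eq hsup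
  simp only [Finset.mem_product, Finset.mem_range] at hmem hxy
  have h₁ := c.le_sub_left x y
  have h₂ := c.le_sub_right x y
  have hpos : 1 ≤ c.val x y := by
    by_contra h0
    refine hc.1 (isMin_iff_eq_bot.2 (ext_val fun x' y' => ?_))
    have := least_val_le (a := a) (m := m) x y (c.val x y) x' y'
    rw [hxy] at this
    rw [bot_val]
    omega
  by_cases hx : x = 0
  · subst hx
    have hglue : ∀ e : CyclicHeight a m, e.val 0 y = e.val (y - m) 0 := by
      intro e
      rcases le_total y m with h | h
      · rw [e.eq_of_le_m h, Nat.sub_eq_zero_of_le h]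
      · rw [← e.glue, Nat.sub_add_cancel h]
    refine ⟨y - m, 0, c.val 0 y, ⟨hpos, by omega, by omega, fun _ => rfl⟩, ?_⟩
    refine hxy.symm.trans (eq_of_forall_ge_iff fun e => ?_)
    rw [least_le_iff (by omega) (by omega), least_le_iff (by omega) (by omega), hglue c, hglue e]
  · exact ⟨x, y, c.val x y, ⟨hpos, by omega, by omega, fun h => absurd h hx⟩, hxy.symm⟩

theorem supIrred_map_orderIso {α β : Type*} [SemilatticeSup α] [SemilatticeSup β] (f : α ≃o β)
    {c : α} (hc : SupIrred c) : SupIrred (f c) := by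
  refine ⟨fun h => hc.1 fun b hb => ?_, fun b e h => ?_⟩
  · exact f.le_iff_le.1 (h (f.le_iff_le.2 hb))
  · have hsup : f.symm b ⊔ f.symm e = c := by rw [← f.symm.map_sup, h, f.symm_apply_apply]
    exact (hc.2 hsup).imp (fun h => by rw [← h, f.apply_symm_apply])
      (fun h => by rw [← h, f.apply_symm_apply])

/-- If everything strictly below the box `(x, y, h)` is strictly below `(x', y', h')`, then
the boxes that `(x, y, h)` can cover are below `(x', y', h')`. -/
theorem boxLE_of_forall_lt {x y h x' y' h' : ℕ} (hp : IsBox a m x y h) (hq : IsBox a m x' y' h')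
    (hlt : ∀ e : CyclicHeight a m, e < least x y h → e < least x' y' h') :
    (2 ≤ x ∨ 1 ≤ x ∧ y = 0 → BoxLE m (x - 1) y h x' y' h') ∧
    (x = 1 → 1 ≤ y → BoxLE m (y - m) 0 h x' y' h') ∧
    (1 ≤ y → BoxLE m x (y - 1) h x' y' h') ∧
    (2 ≤ h → BoxLE m (x + 1) (y + 1) (h - 1) x' y' h') ∧
    (2 ≤ h → y = 0 → BoxLE m 1 (x + m + 1) (h - 1) x' y' h') := by
  have key : ∀ {u v k}, IsBox a m u v k → BoxLE m u v k x y h → ¬ BoxLE m x y h u v k →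
      BoxLE m u v k x' y' h' := by
    intro u v k hu h₁ h₂
    rw [← least_le_least hu hp] at h₁
    rw [← least_le_least hp hu] at h₂
    rw [← least_le_least hu hq]
    exact (hlt _ (lt_of_le_not_ge h₁ h₂)).le
  obtain ⟨h₁, h₂, h₃, h₄⟩ := hp
  refine ⟨fun hx => key ⟨h₁, ?_, h₃, ?_⟩ ?_ ?_, fun hx hy => key ⟨h₁, ?_, ?_, ?_⟩ ?_ ?_,
    fun hy => key ⟨h₁, h₂, ?_, ?_⟩ ?_ ?_, fun hh => key ⟨?_, ?_, ?_, ?_⟩ ?_ ?_,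
    fun hh hy => key ⟨?_, ?_, ?_, ?_⟩ ?_ ?_⟩
  any_goals omega
  · rw [boxLE_same]; omega
  · rw [boxLE_same]; omega
  · subst hx; rw [boxLE_same]; omega
  · subst hx; rw [boxLE_same]; omega
  · rw [boxLE_same]; omega
  · rw [boxLE_same]; omega
  · exact ⟨by omega, Or.inl ⟨by omega, by omega⟩⟩
  · exact fun hle => absurd hle.1 (by omega)
  · exact ⟨by omega, Or.inr (Or.inr ⟨by omega, by omega⟩)⟩
  · exact fun hle => absurd hle.1 (by omega)

/-- The boxes at the origin are determined by the boxes below them. -/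
theorem false_of_origin {h x' y' h' : ℕ} (hp : IsBox a m 0 0 h) (hq : IsBox a m x' y' h')
    (hx' : x' ≠ 0)
    (n₁ : ¬ BoxLE m 0 0 h x' y' h') (n₂ : ¬ BoxLE m x' y' h' 0 0 h)
    (a₄ : 2 ≤ h → BoxLE m 1 1 (h - 1) x' y' h')
    (a₅ : 2 ≤ h → BoxLE m 1 (m + 1) (h - 1) x' y' h')
    (b₂ : x' = 1 → 1 ≤ y' → BoxLE m (y' - m) 0 h' 0 0 h)
    (b₃ : 1 ≤ y' → BoxLE m x' (y' - 1) h' 0 0 h) : False := by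
  obtain ⟨p₁, p₂, p₃, p₄⟩ := hp
  obtain ⟨q₁, q₂, q₃, q₄⟩ := hq
  have hlt : h' < h := not_le.1 fun hle => n₁ (boxLE_origin hle)
  obtain ⟨h₁, a₅⟩ := a₅ (by omega)
  have a₄ := (a₄ (by omega)).2
  obtain rfl : h = h' + 1 := by omega
  clear n₁ p₄ q₄ h₁
  have hy' : m + 1 ≤ y' := by
    clear b₂ b₃ n₂
    omega
  clear a₄ a₅
  have hy1 : 1 ≤ y' := by omega
  have b₃ := (b₃ hy1).2
  have hx1 : x' = 1 := by
    clear b₂ n₂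
    omega
  subst hx1
  have b₂ := (b₂ rfl hy1).2
  have hy2 : y' ≠ m + 1 := by
    rintro rfl
    exact n₂ ⟨by omega, Or.inr (Or.inr ⟨by omega, by omega⟩)⟩
  clear n₂
  omega

/-- Two boxes away from the origin with the same boxes strictly below them are equal, with one
exception. -/
theorem boxes_eq_of_ne_zero (hma : 1 ≤ m ∨ a ≤ 2) {x y x' y' h : ℕ}
    (hp : IsBox a m x y h) (hq : IsBox a m x' y' h) (hx : x ≠ 0) (hx' : x' ≠ 0)
    (n₁ : ¬ BoxLE m x y h x' y' h) (n₂ : ¬ BoxLE m x' y' h x y h)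
    (a₁ : 2 ≤ x ∨ 1 ≤ x ∧ y = 0 → BoxLE m (x - 1) y h x' y' h)
    (a₃ : 1 ≤ y → BoxLE m x (y - 1) h x' y' h)
    (a₄ : 2 ≤ h → BoxLE m (x + 1) (y + 1) (h - 1) x' y' h)
    (b₁ : 2 ≤ x' ∨ 1 ≤ x' ∧ y' = 0 → BoxLE m (x' - 1) y' h x y h)
    (b₃ : 1 ≤ y' → BoxLE m x' (y' - 1) h x y h)
    (b₄ : 2 ≤ h → BoxLE m (x' + 1) (y' + 1) (h - 1) x y h) :
    (x = 1 ∧ y = 1 ∧ h = 1) ∧ (x' = 2 ∧ y' = 0 ∧ h = 1) ∨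
      (x = 2 ∧ y = 0 ∧ h = 1) ∧ (x' = 1 ∧ y' = 1 ∧ h = 1) := by
  obtain ⟨p₁, p₂, p₃, -⟩ := hp
  obtain ⟨-, q₂, q₃, -⟩ := hq
  have key : ∀ {x y x' y' : ℕ}, y = 0 → 0 < y' → x ≠ 0 → x' ≠ 0 →
      ¬ BoxLE m x y h x' y' h →
      (2 ≤ x ∨ 1 ≤ x ∧ y = 0 → BoxLE m (x - 1) y h x' y' h) →
      (2 ≤ h → BoxLE m (x + 1) (y + 1) (h - 1) x' y' h) →
      (2 ≤ x' ∨ 1 ≤ x' ∧ y' = 0 → BoxLE m (x' - 1) y' h x y h) →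
      BoxLE m x' (y' - 1) h x y h →
      (x = 2 ∧ y = 0 ∧ h = 1) ∧ (x' = 1 ∧ y' = 1 ∧ h = 1) := by
    rintro x _ x' y' rfl hy' hx hx' n₁ a₁ a₄ b₁ b₃
    rw [boxLE_same] at b₃
    have hlt : x' < x := not_le.1 fun hle => n₁ (boxLE_same.2 (Or.inl ⟨hle, hy'.le⟩))
    clear n₁
    obtain rfl : y' = 1 := by
      clear a₁ a₄ b₁
      omega
    obtain rfl : x' = 1 := by
      by_contra hne
      have hb := boxLE_same.1 (b₁ (Or.inl (by omega)))
      clear a₁ a₄ b₁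
      omega
    have ha := boxLE_same.1 (a₁ (Or.inl hlt))
    clear a₁ b₁
    obtain rfl : x = 2 := by
      clear a₄
      omega
    by_cases h2 : 2 ≤ h
    · have := (a₄ h2).2
      clear a₄
      omega
    · exact ⟨⟨rfl, rfl, by omega⟩, rfl, rfl, by omega⟩
  rcases Nat.eq_zero_or_pos y with hy | hy <;> rcases Nat.eq_zero_or_pos y' with hy' | hy'
  · exact ((le_total x x').elim (fun hle => n₁ (boxLE_same.2 (Or.inl ⟨hle, by rw [hy, hy']⟩)))
      fun hle => n₂ (boxLE_same.2 (Or.inl ⟨hle, by rw [hy, hy']⟩))).elim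
  · exact Or.inr (key hy hy' hx hx' n₁ a₁ a₄ b₁ (b₃ hy'))
  · exact Or.inl (And.comm.1 (key hy' hy hx' hx n₂ b₁ b₄ a₁ (a₃ hy)))
  have ha := a₃ hy
  have hb := b₃ hy'
  clear a₃ b₃ a₄ b₄ key
  simp only [boxLE_same] at n₁ n₂ a₁ b₁ ha hb
  exfalso
  rcases Nat.lt_or_ge x 2 with hx2 | hx2 <;> rcases Nat.lt_or_ge x' 2 with hx2' | hx2'
  · clear a₁ b₁
    omega
  · have hb' := b₁ (Or.inl hx2')
    clear a₁ b₁
    omega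
  · have ha' := a₁ (Or.inl hx2)
    clear a₁ b₁
    omega
  · have ha' := a₁ (Or.inl hx2)
    have hb' := b₁ (Or.inl hx2')
    clear a₁ b₁
    omega

/-- A sup-irreducible element is almost determined by the elements strictly below it. -/
theorem least_eq_or_of_forall_lt_iff (hma : 1 ≤ m ∨ a ≤ 2) {x y h x' y' h' : ℕ}
    (hp : IsBox a m x y h) (hq : IsBox a m x' y' h')
    (hlt : ∀ e : CyclicHeight a m, e < least x y h ↔ e < least x' y' h') :
    (least x y h : CyclicHeight a m) = least x' y' h' ∨
      (x = 1 ∧ y = 1 ∧ h = 1) ∧ (x' = 2 ∧ y' = 0 ∧ h' = 1) ∨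
      (x = 2 ∧ y = 0 ∧ h = 1) ∧ (x' = 1 ∧ y' = 1 ∧ h' = 1) := by
  refine or_iff_not_imp_left.2 fun hne => ?_
  have n₁ : ¬ BoxLE m x y h x' y' h' := fun hle =>
    lt_irrefl _ ((hlt _).2 (lt_of_le_of_ne ((least_le_least hp hq).2 hle) hne))
  have n₂ : ¬ BoxLE m x' y' h' x y h := fun hle =>
    lt_irrefl _ ((hlt _).1 (lt_of_le_of_ne ((least_le_least hq hp).2 hle) (Ne.symm hne)))
  obtain ⟨a₁, a₂, a₃, a₄, a₅⟩ := boxLE_of_forall_lt hp hq fun e => (hlt e).1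
  obtain ⟨b₁, b₂, b₃, b₄, b₅⟩ := boxLE_of_forall_lt hq hp fun e => (hlt e).2
  by_cases hx : x = 0
  · obtain rfl := hp.repr hx
    subst hx
    by_cases hx' : x' = 0
    · obtain rfl := hq.repr hx'
      subst hx'
      exact ((le_total h h').elim (fun hle => n₁ (boxLE_origin hle))
        fun hle => n₂ (boxLE_origin hle)).elim
    · simp only [zero_add, forall_true_left] at a₄ a₅
      exact (false_of_origin hp hq hx' n₁ n₂ a₄ a₅ b₂ b₃).elim
  by_cases hx' : x' = 0
  · obtain rfl := hq.repr hx'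
    subst hx'
    simp only [zero_add, forall_true_left] at b₄ b₅
    exact (false_of_origin hq hp hx n₂ n₁ b₄ b₅ a₂ a₃).elim
  have hh : h ≤ h' := by
    by_cases h2 : 2 ≤ x ∨ 1 ≤ x ∧ y = 0
    · exact (a₁ h2).1
    · exact (a₂ (by omega) (by omega)).1
  have hh' : h' ≤ h := by
    by_cases h2 : 2 ≤ x' ∨ 1 ≤ x' ∧ y' = 0
    · exact (b₁ h2).1
    · exact (b₂ (by omega) (by omega)).1
  obtain rfl : h = h' := le_antisymm hh hh'
  exact boxes_eq_of_ne_zero hma hp hq hx hx' n₁ n₂ a₁ a₃ a₄ b₁ b₃ b₄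

end CyclicHeight

namespace CyclicHeight

variable {a m : ℕ}

/-- An automorphism that fixes everything strictly below a sup-irreducible element fixes this
element, unless it is one of the two elements that are not determined by what is below them. -/
theorem map_least_eq_or (hma : 1 ≤ m ∨ a ≤ 2) (f : CyclicHeight a m ≃o CyclicHeight a m)
    {x y h : ℕ} (hp : IsBox a m x y h)
    (hfix : ∀ e, e < least x y h → f e = e) :
    f (least x y h) = least x y h ∨ 3 ≤ a ∧
      ((x = 1 ∧ y = 1 ∧ h = 1) ∧ f (least 1 1 1) = least 2 0 1 ∨
        (x = 2 ∧ y = 0 ∧ h = 1) ∧ f (least 2 0 1) = least 1 1 1) := by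
  obtain ⟨x', y', h', hq, hf⟩ := exists_eq_least (supIrred_map_orderIso f (supIrred_least hp))
  have hiff : ∀ e : CyclicHeight a m, e < least x y h ↔ e < least x' y' h' := by
    intro e
    rw [← hf]
    refine ⟨fun he => ?_, fun he => ?_⟩
    · rw [← hfix e he]
      exact f.lt_iff_lt.2 he
    · have h₁ : f.symm e < least x y h := by
        rw [← f.lt_iff_lt, f.apply_symm_apply]
        exact he
      have h₂ := hfix _ h₁
      rw [f.apply_symm_apply] at h₂
      rwa [h₂]
  rcases least_eq_or_of_forall_lt_iff hma hp hq hiff with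
    heq | ⟨⟨rfl, rfl, rfl⟩, rfl, rfl, rfl⟩ | ⟨⟨rfl, rfl, rfl⟩, rfl, rfl, rfl⟩
  · exact Or.inl (hf.trans heq.symm)
  · exact Or.inr ⟨hq.left, Or.inl ⟨⟨rfl, rfl, rfl⟩, hf⟩⟩
  · exact Or.inr ⟨hp.left, Or.inr ⟨⟨rfl, rfl, rfl⟩, hf⟩⟩

/-- No automorphism interchanges the two elements that have the same elements strictly below them.
The box `(1, m + 2, 1)` is above both of them.  Its image under such an automorphism would have to
be `(2, 1, 1)`; but `(1, 2, 1)`, which lies strictly between `(1, 1, 1)` and `(1, m + 2, 1)`, would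
then be mapped strictly between `(2, 0, 1)` and `(2, 1, 1)`, where there is no box. -/
theorem not_swap (hm : 1 ≤ m) (ha : 3 ≤ a) (f : CyclicHeight a m ≃o CyclicHeight a m)
    (h₁ : f (least 1 1 1) = least 2 0 1) (h₂ : f (least 2 0 1) = least 1 1 1) : False := by
  have b₁ : IsBox a m 1 1 1 := ⟨by omega, by omega, by omega, by omega⟩
  have b₂ : IsBox a m 2 0 1 := ⟨by omega, by omega, by omega, by omega⟩
  have b₃ : IsBox a m 1 2 1 := ⟨by omega, by omega, by omega, by omega⟩
  have b₄ : IsBox a m 2 1 1 := ⟨by omega, by omega, by omega, by omega⟩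
  have b₅ : IsBox a m 1 (m + 2) 1 := ⟨by omega, by omega, by omega, by omega⟩
  -- the box `(1, m + 2, 1)` is above both elements, and so is its image
  obtain ⟨x, y, h, hq, hf⟩ := exists_eq_least (supIrred_map_orderIso f (supIrred_least b₅))
  have i₁ : (least 1 1 1 : CyclicHeight a m) ≤ least 1 (m + 2) 1 :=
    (least_le_least b₁ b₅).2 (boxLE_same.2 (by omega))
  have i₂ : (least 2 0 1 : CyclicHeight a m) ≤ least 1 (m + 2) 1 :=
    (least_le_least b₂ b₅).2 (boxLE_same.2 (by omega))
  have j₁ := f.monotone i₁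
  have j₂ := f.monotone i₂
  rw [h₁, hf, least_le_least b₂ hq] at j₁
  rw [h₂, hf, least_le_least b₁ hq] at j₂
  by_cases hc : BoxLE m 1 2 1 x y h
  · -- the preimage of `(1, 2, 1)` is above `(2, 0, 1)` and below `(1, m + 2, 1)`,
    -- but not above `(1, 1, 1)`
    obtain ⟨u, v, k, hu, hs⟩ :=
      exists_eq_least (supIrred_map_orderIso f.symm (supIrred_least b₃))
    have hs' : f (least u v k) = least 1 2 1 := by rw [← hs, f.apply_symm_apply]
    have k₁ : BoxLE m u v k 1 (m + 2) 1 := by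
      rw [← least_le_least hu b₅, ← f.le_iff_le, hs', hf, least_le_least b₃ hq]
      exact hc
    have k₂ : BoxLE m 2 0 1 u v k := by
      rw [← least_le_least b₂ hu, ← f.le_iff_le, hs', h₂, least_le_least b₁ b₃]
      exact boxLE_same.2 (by omega)
    have k₃ : ¬ BoxLE m 1 1 1 u v k := by
      rw [← least_le_least b₁ hu, ← f.le_iff_le, hs', h₁, least_le_least b₂ b₃, boxLE_same]
      omega
    obtain rfl : k = 1 := le_antisymm k₁.1 hu.pos
    rw [boxLE_same] at k₁ k₂ k₃
    have hur := hu.repr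
    obtain rfl : u = 2 := by omega
    obtain rfl : v = 0 := by omega
    rw [h₂] at hs'
    have := (least_le_least b₃ b₁).1 hs'.ge
    rw [boxLE_same] at this
    omega
  · -- the image is `(x, 1, 1)`, hence above `(2, 1, 1)`, whose preimage must be `(1, m + 2, 1)`
    have hh : h = 1 := by
      by_contra hne
      have := hq.pos
      exact hc ⟨by omega, Or.inr (Or.inr ⟨by omega, by omega⟩)⟩
    subst hh
    rw [boxLE_same] at j₁ j₂ hc
    obtain rfl : y = 1 := by omega
    have hx : 2 ≤ x := by omega
    clear j₁ j₂ hc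
    obtain ⟨u, v, k, hu, hs⟩ :=
      exists_eq_least (supIrred_map_orderIso f.symm (supIrred_least b₄))
    have hs' : f (least u v k) = least 2 1 1 := by rw [← hs, f.apply_symm_apply]
    have k₁ : BoxLE m u v k 1 (m + 2) 1 := by
      rw [← least_le_least hu b₅, ← f.le_iff_le, hs', hf, least_le_least b₄ hq]
      exact boxLE_same.2 (by omega)
    have k₂ : BoxLE m 2 0 1 u v k := by
      rw [← least_le_least b₂ hu, ← f.le_iff_le, hs', h₂, least_le_least b₁ b₄]
      exact boxLE_same.2 (by omega)
    have k₃ : BoxLE m 1 1 1 u v k := by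
      rw [← least_le_least b₁ hu, ← f.le_iff_le, hs', h₁, least_le_least b₂ b₄]
      exact boxLE_same.2 (by omega)
    obtain rfl : k = 1 := le_antisymm k₁.1 hu.pos
    rw [boxLE_same] at k₁ k₂ k₃
    have hur := hu.repr
    obtain rfl : u = 1 := by omega
    obtain rfl : v = m + 2 := by omega
    clear k₁ k₂ k₃
    -- now `(1, 2, 1)` would be mapped strictly between `(2, 0, 1)` and `(2, 1, 1)`
    obtain ⟨u, v, k, hv, ht⟩ :=
      exists_eq_least (supIrred_map_orderIso f (supIrred_least b₃))
    have l₁ : BoxLE m u v k 2 1 1 := by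
      rw [← least_le_least hv b₄, ← hs', ← ht, f.le_iff_le, least_le_least b₃ b₅]
      exact boxLE_same.2 (by omega)
    have l₂ : BoxLE m 2 0 1 u v k := by
      rw [← least_le_least b₂ hv, ← h₁, ← ht, f.le_iff_le, least_le_least b₁ b₃]
      exact boxLE_same.2 (by omega)
    have l₃ : ¬ BoxLE m u v k 2 0 1 := by
      rw [← least_le_least hv b₂, ← h₁, ← ht, f.le_iff_le, least_le_least b₃ b₁, boxLE_same]
      omega
    have l₄ : ¬ BoxLE m 2 1 1 u v k := by
      rw [← least_le_least b₄ hv, ← hs', ← ht, f.le_iff_le, least_le_least b₅ b₃, boxLE_same]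
      omega
    obtain rfl : k = 1 := le_antisymm l₁.1 hv.pos
    rw [boxLE_same] at l₁ l₂ l₃ l₄
    have hvr := hv.repr
    omega

/-- The lattice of cyclic height functions has no automorphism but the identity. -/
theorem orderIso_apply_eq (hma : 1 ≤ m ∨ a ≤ 2) (f : CyclicHeight a m ≃o CyclicHeight a m)
    (c : CyclicHeight a m) : f c = c := by
  induction c using WellFoundedLT.induction with
  | ind c ih =>
  by_cases hc : SupIrred c
  · obtain ⟨x, y, h, hp, rfl⟩ := exists_eq_least hc
    -- The two exceptional elements have the same elements strictly below them, so that an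
    -- automorphism moving one of them has to interchange them.
    have hlower : ∀ {p q : CyclicHeight a m}, f p = q → (∀ e, e < p → f e = e) →
        ∀ e, e < q → f e = e := by
      rintro p _ rfl hlt e he
      have h₁ : f.symm e < p := by
        rwa [← f.lt_iff_lt, f.apply_symm_apply]
      have h₂ := hlt _ h₁
      rw [f.apply_symm_apply] at h₂
      rw [h₂, hlt _ h₁, ← h₂]
    rcases map_least_eq_or hma f hp ih with heq | ⟨ha, hcase⟩
    · exact heq
    exfalso
    have hm : 1 ≤ m := by omega
    have b₁ : IsBox a m 1 1 1 := ⟨by omega, by omega, by omega, by omega⟩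
    have b₂ : IsBox a m 2 0 1 := ⟨by omega, by omega, by omega, by omega⟩
    have hne : (least 1 1 1 : CyclicHeight a m) ≠ least 2 0 1 := by
      intro h
      have := (least_le_least b₁ b₂).1 h.le
      rw [boxLE_same] at this
      omega
    rcases hcase with ⟨⟨rfl, rfl, rfl⟩, h₁⟩ | ⟨⟨rfl, rfl, rfl⟩, h₁⟩
    · rcases map_least_eq_or hma f b₂ (hlower h₁ ih) with h₂ | ⟨-, h₂ | ⟨-, h₂⟩⟩
      · exact hne (f.injective (h₁.trans h₂.symm))
      · omega
      · exact not_swap hm ha f h₁ h₂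
    · rcases map_least_eq_or hma f b₁ (hlower h₁ ih) with h₂ | ⟨-, ⟨-, h₂⟩ | h₂⟩
      · exact hne (f.injective (h₂.trans h₁.symm))
      · exact not_swap hm ha f h₂ h₁
      · omega
  · unfold SupIrred at hc
    rw [not_and_or, not_not] at hc
    rcases hc with hc | hc
    · rw [isMin_iff_eq_bot] at hc
      rw [hc, f.map_bot]
    · push Not at hc
      obtain ⟨b, e, rfl, hb, he⟩ := hc
      rw [f.map_sup, ih b (lt_of_le_of_ne le_sup_left hb), ih e (lt_of_le_of_ne le_sup_right he)]

end CyclicHeight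

/-! ### Lattice, bijection, reflection and uniqueness -/

theorem mainTheorem3 (d : ℤ) (n : ℕ) (hd : d ≤ 2) (hn : 0 ≤ (n : ℤ) + d - 1) :
    -- `d`-descending plane partitions with entries `≤ n` form a lattice
    (∀ π σ : DescendingPP d n, (∃ ρ, IsLUB {π, σ} ρ) ∧ (∃ ρ, IsGLB {π, σ} ρ)) ∧
    -- reading off the lattice paths of a tiling is a bijection
    ∃ φ : DescendingPP d n ≃ CSRhombusTiling ((n : ℤ) + d - 1) ((n : ℤ) + 1),
      (∀ π, ReadOff ((n : ℤ) + d - 1) ((n : ℤ) + 1) (φ π).1 π) ∧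
      -- reflection of the tiling is an antiautomorphism, and the only one
      ∃ τ : DescendingPP d n ≃o (DescendingPP d n)ᵒᵈ,
        (∀ π, (φ (OrderDual.ofDual (τ π))).1 = Rhombus.reflect '' (φ π).1) ∧
        (d ≤ 1 ∨ n ≤ 1 → ∀ τ' : DescendingPP d n ≃o (DescendingPP d n)ᵒᵈ, τ' = τ) := by
  obtain ⟨a, ha⟩ := Int.eq_ofNat_of_zero_le hn
  obtain ⟨m, hm⟩ := Int.eq_ofNat_of_zero_le (show 0 ≤ 2 - d by omega)
  obtain ⟨e, he⟩ := DescendingPP.exists_orderIso_matches (n := n) ha hm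
  rw [ha, show (n : ℤ) + 1 = (a : ℤ) + m by omega]
  refine ⟨fun π σ => ⟨⟨e.symm (e π ⊔ e σ), ?_⟩, ⟨e.symm (e π ⊓ e σ), ?_⟩⟩,
    e.toEquiv.trans CyclicHeight.tilingEquiv, fun π => CyclicHeight.readOff_tiling hm (he π),
    (e.trans CyclicHeight.reflectIso).trans e.symm.dual, fun π => ?_, fun hdn τ' => ?_⟩
  · rw [← e.isLUB_image', Set.image_pair, e.apply_symm_apply]
    exact isLUB_pair
  · rw [← e.isGLB_image', Set.image_pair, e.apply_symm_apply]
    exact isGLB_pair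
  · change (CyclicHeight.tilingEquiv (e (e.symm (e π).reflect))).1 = _
    rw [e.apply_symm_apply]
    exact CyclicHeight.tiling_reflect (e π)
  · -- composing an antiautomorphism with the reflection yields an automorphism
    refine DFunLike.ext _ _ fun π => e.dual.injective ?_
    have h := CyclicHeight.orderIso_apply_eq (by omega)
      (((e.symm.trans τ').trans e.dual).trans CyclicHeight.reflectIso.symm) (e π)
    have h' := congrArg CyclicHeight.reflectIso h
    simp only [OrderIso.trans_apply, OrderIso.apply_symm_apply, OrderIso.symm_apply_apply] at h'
    rw [h']
    simp only [OrderIso.trans_apply]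
    exact (e.dual.apply_symm_apply _).symm
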